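/- Let $n,m\ge 1$. Let $A_{n,m}$ be the planar tree with one vertex (the central one) of valence $m$ and all other vertices of valence $n+1$, and let $\mathscr S(A_{n,m})$ be the surface with boundary obtained by embedding $A_{n,m}$ in the plane and thickening it. Let $\mathscr S^\sharp(A_{n,m})$ be $\mathscr S(A_{n,m})$ with a puncture at every vertex of the tree, and $\mathscr S^*(A_{n,m})$ be $\mathscr S(A_{n,m})$ with a puncture at every vertex except the central one. Each of them is divided into polygons, one for each vertex of the tree and containing that vertex in its interior, by a family of pairwise disjoint arcs with endpoints on the boundary, one for each edge, crossing that edge once and transversely and no other edge (the rigid structure). An admissible subsurface is a connected finite union of polygons. A homeomorphism $\phi$ of the surface onto itself is asymptotically rigid if there is an admissible subsurface $\Sigma$ such that $\phi(\Sigma)$ is admissible and $\phi$ sends every polygon not contained in $\Sigma$ to a polygon. Let $\mathfrak{amod}(\mathscr S^\sharp(A_{n,m}))$ and $\mathfrak{amod}(\mathscr S^*(A_{n,m}))$ be the groups of isotopy classes of orientation-preserving asymptotically rigid homeomorphisms of $\mathscr S^\sharp(A_{n,m})$ and of $\mathscr S^*(A_{n,m})$, respectively (isotopies run through arbitrary homeomorphisms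 of the surface). **Lemma.** For all integers $m\ge n\ge 1$ there is a group isomorphism $$\mathfrak{amod}(\mathscr S^\sharp(A_{n,m}))\;\cong\;\mathfrak{amod}(\mathscr S^*(A_{n,m-n+1})).$$ More precisely, there are a neighbour $b$ of the central vertex of $A_{n,m-n+1}$ and a homeomorphism $\psi:\mathscr S^\sharp(A_{n,m})\to\mathscr S^*(A_{n,m-n+1})$ which sends the central polygon to the union of the central polygon and the polygon of $b$, and which maps the other polygons of $\mathscr S^\sharp(A_{n,m})$ bijectively to the other polygons of $\mathscr S^*(A_{n,m-n+1})$, such that $[\phi]\mapsto[\psi\phi\psi^{-1}]$ is a well-defined isomorphism between these groups. -/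

import Mathlib

open Set

namespace ArborealSurface

/-! ### The planar tree `A_{n,m}` -/

/-- Vertices of the tree `A_{n,m}`: the central vertex `root`, and `node i l` for the vertex reached
from the root by going to its `i`-th neighbour and then following `l` (read from the right: in
`node i (j :: l)` the last step goes to the `j`-th child of `node i l`). -/
inductive Vertex (n m : ℕ) : Type
  | root : Vertex n m
  | node (i : Fin m) (l : List (Fin n)) : Vertex n m

/-- `IsChild v w`: the vertex `w` is a child of the vertex `v`. -/
inductive IsChild {n m : ℕ} : Vertex n m → Vertex n m → Prop
  | ofRoot (i : Fin m) : IsChild .root (.node i [])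
  | ofNode (i : Fin m) (j : Fin n) (l : List (Fin n)) : IsChild (.node i l) (.node i (j :: l))

/-- The tree `A_{n,m}`: the central vertex has valence `m` and all the others have valence
`n + 1` (one parent and `n` children). Neighbours are ordered from left to right by their index,
which is the planar structure. -/
def tree (n m : ℕ) : SimpleGraph (Vertex n m) := SimpleGraph.fromRel IsChild

/-! ### The arboreal surface, as a subset of the plane

The polygon of the central vertex is the rectangle `[0,1] × [-1,0]`; `m` pairwise disjoint segments
of its top side are the arcs separating it from the polygons of the neighbours of the centre.
The polygon of a vertex at distance `k + 1` from the centre is a trapezoid lying between the heights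
`k` and `k + 1`. Its bottom side is the arc shared with the polygon of the parent, and `n` pairwise
disjoint segments of its top side are the arcs shared with the polygons of the children. -/

/-- Length of the bottom side of the polygon of `node i l`. -/
noncomputable def width (n m : ℕ) (l : List (Fin n)) : ℝ :=
  1 / ((2 * m + 1) * (2 * n + 1) ^ l.length)

/-- Abscissa of the left end of the bottom side of the polygon of `node i l`. -/
noncomputable def left (n m : ℕ) (i : Fin m) : List (Fin n) → ℝ
  | [] => (2 * (i : ℕ) + 1) / (2 * m + 1)
  | j :: l => left n m i l + (2 * (j : ℕ) + 1) * width n m (j :: l)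

/-- The closed polygon containing a vertex (before puncturing), a closed region of the plane. -/
def closedPolygon (n m : ℕ) : Vertex n m → Set ℂ
  | .root => {z | 0 ≤ z.re ∧ z.re ≤ 1 ∧ -1 ≤ z.im ∧ z.im ≤ 0}
  | .node i l => {z | (l.length : ℝ) ≤ z.im ∧ z.im ≤ l.length + 1 ∧
      (z.im - l.length) * width n m l ≤ (2 * n + 2) * (z.re - left n m i l) ∧
      (z.im - l.length) * width n m l ≤ (2 * n + 2) * (left n m i l + width n m l - z.re)}

/-- The position in the plane of the vertices of the tree: the centre of each polygon. -/
noncomputable def vertexPoint (n m : ℕ) : Vertex n m → ℂ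
  | .root => ⟨1 / 2, -1 / 2⟩
  | .node i l => ⟨left n m i l + width n m l / 2, l.length + 1 / 2⟩

/-- The arboreal surface of `A_{n,m}` with a puncture at each vertex belonging to `X`. -/
def surface (n m : ℕ) (X : Set (Vertex n m)) : Set ℂ :=
  (⋃ v, closedPolygon n m v) \ (vertexPoint n m '' X)

/-- The polygons of the rigid structure, as subsets of the punctured surface. -/
def polygon (n m : ℕ) (X : Set (Vertex n m)) (v : Vertex n m) : Set (surface n m X) :=
  Subtype.val ⁻¹' closedPolygon n m v

/-- For `𝒮^♯(A_{n,m})` every vertex is a puncture. -/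
def sharp (n m : ℕ) : Set (Vertex n m) := univ

/-- For `𝒮^*(A_{n,m})` every vertex except the central one is a puncture. -/
def star (n m : ℕ) : Set (Vertex n m) := {Vertex.root}ᶜ

/-! ### Isotopies -/

/-- Two homeomorphisms are isotopic if they are joined by a continuous family of homeomorphisms. -/
def Isotopic {S : Type*} [TopologicalSpace S] (f g : S ≃ₜ S) : Prop :=
  ∃ H : unitInterval × S → S, Continuous H ∧ (∀ t, IsHomeomorph fun x => H (t, x)) ∧
    (∀ x, H (0, x) = f x) ∧ ∀ x, H (1, x) = g x

/-- The group of homeomorphisms isotopic to the identity. -/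
def isotopicToId (S : Type*) [TopologicalSpace S] : Subgroup (S ≃ₜ S) where
  carrier := {f | Isotopic 1 f}
  one_mem' := ⟨fun p => p.2, continuous_snd, fun _ => (Homeomorph.refl S).isHomeomorph,
    fun _ => rfl, fun _ => rfl⟩
  mul_mem' := by
    rintro f g ⟨H, hH, hh, h0, h1⟩ ⟨K, hK, kh, k0, k1⟩
    refine ⟨fun p => H (p.1, K p), by fun_prop, fun t => (hh t).comp (kh t), fun x => ?_,
      fun x => ?_⟩
    · simp [h0, k0]
    · simp [h1, k1]
  inv_mem' := by
    rintro f ⟨H, hH, hh, h0, h1⟩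
    refine ⟨fun p => H (unitInterval.symm p.1, f.symm p.2), ?_, fun t =>
      (hh (unitInterval.symm t)).comp f.symm.isHomeomorph, fun x => ?_, fun x => ?_⟩
    · fun_prop
    · simp [h1]
    · simp [h0]

instance (S : Type*) [TopologicalSpace S] : (isotopicToId S).Normal where
  conj_mem := by
    rintro f ⟨H, hH, hh, h0, h1⟩ g
    refine ⟨fun p => g (H (p.1, g.symm p.2)), by fun_prop, fun t =>
      g.isHomeomorph.comp ((hh t).comp g.symm.isHomeomorph), fun x => ?_, fun x => ?_⟩
    · simp [h0]
    · simp [h1]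

/-- Isotopy classes of homeomorphisms are the cosets of the group of homeomorphisms isotopic to the
identity. -/
theorem isotopic_iff {S : Type*} [TopologicalSpace S] (f g : S ≃ₜ S) :
    Isotopic f g ↔ f⁻¹ * g ∈ isotopicToId S := by
  constructor
  · rintro ⟨H, hH, hh, h0, h1⟩
    refine ⟨fun p => f.symm (H p), by fun_prop, fun t => f.symm.isHomeomorph.comp (hh t),
      fun x => ?_, fun x => ?_⟩
    · simp [h0]
    · simp [h1]
  · rintro ⟨H, hH, hh, h0, h1⟩
    refine ⟨fun p => f (H p), by fun_prop, fun t => f.isHomeomorph.comp (hh t),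
      fun x => ?_, fun x => ?_⟩
    · simp [h0]
    · simp [h1]

/-! ### Orientation -/

/-- The closed curve `γ` avoids the point `p` and winds `k` times around it: a continuous
logarithm of `γ - p` grows by `2πik` along the circle. -/
def HasWinding (γ : Circle → ℂ) (p : ℂ) (k : ℤ) : Prop :=
  ∃ L : ℝ → ℂ, Continuous L ∧ (∀ t, Complex.exp (L t) = γ (Circle.exp t) - p) ∧
    L (2 * Real.pi) = L 0 + 2 * Real.pi * Complex.I * k

/-- A homeomorphism of a subsurface of the plane is orientation-preserving if it preserves the
winding number around points of the surface of the closed curves that are contractible in the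
surface (for instance, of the boundary of a small disc around an interior point). -/
def OrientationPreserving {S : Set ℂ} (f : S ≃ₜ S) : Prop :=
  ∀ γ : C(Circle, S), γ.Nullhomotopic → ∀ (p : S) (k : ℤ),
    HasWinding (fun t => (γ t : ℂ)) p k ↔ HasWinding (fun t => (f (γ t) : ℂ)) (f p) k

/-- The group of orientation-preserving homeomorphisms. -/
def homeoPlus (S : Set ℂ) : Subgroup (S ≃ₜ S) where
  carrier := {f | OrientationPreserving f}
  one_mem' := fun _ _ _ _ => Iff.rfl
  mul_mem' := by
    intro f g hf hg γ hγ p k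
    exact (hg γ hγ p k).trans
      (hf ((g : C(S, S)).comp γ) (hγ.comp_right _) (g p) k)
  inv_mem' := by
    intro f hf γ hγ p k
    have h := hf ((f.symm : C(S, S)).comp γ) (hγ.comp_right _) (f.symm p) k
    simpa using h.symm

/-! ### Admissible subsurfaces and asymptotically rigid homeomorphisms -/

section Rigid

variable {S V : Type*} [TopologicalSpace S]

/-- An admissible subsurface is a connected finite union of polygons. -/
def Admissible (P : V → Set S) (A : Set S) : Prop :=
  IsConnected A ∧ ∃ F : Finset V, A = ⋃ v ∈ F, P v

/-- The admissible subsurface `A` is a support of `f`: its image is admissible, and every polygon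
outside `A` is sent to a polygon. -/
def IsSupport (P : V → Set S) (f : S ≃ₜ S) (A : Set S) : Prop :=
  Admissible P A ∧ Admissible P (f '' A) ∧ ∀ v, ¬ P v ⊆ A → ∃ w, f '' P v = P w

/-- Asymptotically rigid homeomorphisms. -/
def AsymptoticallyRigid (P : V → Set S) (f : S ≃ₜ S) : Prop :=
  ∃ A, IsSupport P f A

/-- The facts about a family of polygons that make asymptotically rigid homeomorphisms a group. -/
structure IsPolygonDecomposition (P : V → Set S) : Prop where
  cover : ∀ x, ∃ v, x ∈ P v
  core : ∀ v, ∃ x ∈ P v, ∀ w, x ∈ P w → w = v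
  extend : ∀ F : Finset V, ∃ A, Admissible P A ∧ ∀ v ∈ F, P v ⊆ A

variable {P : V → Set S}

/-- An admissible subsurface containing a support is a support. -/
theorem IsSupport.mono {f : S ≃ₜ S} {A B : Set S} (h : IsSupport P f A) (hB : Admissible P B)
    (hAB : A ⊆ B) : IsSupport P f B := by
  classical
  obtain ⟨hA, ⟨hfA, G, hG⟩, hr⟩ := h
  refine ⟨hB, ⟨hB.1.image _ f.continuous.continuousOn, ?_⟩, fun v hv => hr v fun h =>
    hv (h.trans hAB)⟩
  obtain ⟨-, K, rfl⟩ := hB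
  have hr' : ∀ v, ∃ w, ¬ P v ⊆ A → f '' P v = P w := by
    intro v
    by_cases hv : P v ⊆ A
    · exact ⟨v, fun h => absurd hv h⟩
    · obtain ⟨w, hw⟩ := hr v hv
      exact ⟨w, fun _ => hw⟩
  choose τ hτ using hr'
  refine ⟨G ∪ (K.filter fun v => ¬ P v ⊆ A).image τ, ?_⟩
  apply Subset.antisymm
  · rintro _ ⟨x, hx, rfl⟩
    simp only [mem_iUnion] at hx
    obtain ⟨v, hv, hxv⟩ := hx
    by_cases hvA : P v ⊆ A
    · have : f x ∈ ⋃ v ∈ G, P v := hG ▸ mem_image_of_mem f (hvA hxv)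
      simp only [mem_iUnion] at this ⊢
      obtain ⟨w, hw, h⟩ := this
      exact ⟨w, Finset.mem_union_left _ hw, h⟩
    · simp only [mem_iUnion]
      refine ⟨τ v, Finset.mem_union_right _ (Finset.mem_image_of_mem _
        (Finset.mem_filter.2 ⟨hv, hvA⟩)), ?_⟩
      rw [← hτ v hvA]
      exact mem_image_of_mem f hxv
  · refine iUnion₂_subset fun w hw => ?_
    rcases Finset.mem_union.1 hw with hw | hw
    · have : P w ⊆ ⋃ v ∈ G, P v := subset_biUnion_of_mem (u := P) (Finset.mem_coe.2 hw)
      exact (this.trans hG.symm.subset).trans (image_mono hAB)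
    · obtain ⟨v, hv, rfl⟩ := Finset.mem_image.1 hw
      obtain ⟨hv, hvA⟩ := Finset.mem_filter.1 hv
      rw [← hτ v hvA]
      exact image_mono (subset_biUnion_of_mem (u := P) (Finset.mem_coe.2 hv))

/-- A support can be enlarged to contain finitely many given polygons. -/
theorem IsSupport.enlarge (hP : IsPolygonDecomposition P) {f : S ≃ₜ S} {A : Set S}
    (h : IsSupport P f A) (F : Finset V) :
    ∃ B, IsSupport P f B ∧ A ⊆ B ∧ ∀ v ∈ F, P v ⊆ B := by
  classical
  obtain ⟨-, G, hG⟩ := h.1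
  obtain ⟨B, hB, hK⟩ := hP.extend (G ∪ F)
  have hAB : A ⊆ B := by
    rw [hG]
    exact iUnion₂_subset fun v hv => hK v (Finset.mem_union_left _ hv)
  exact ⟨B, h.mono hB hAB, hAB, fun v hv => hK v (Finset.mem_union_right _ hv)⟩

/-- Each polygon outside the image of a support is the image of a polygon outside the support. -/
theorem IsSupport.exists_preimage (hP : IsPolygonDecomposition P) {f : S ≃ₜ S} {A : Set S}
    (h : IsSupport P f A) {w : V} (hw : ¬ P w ⊆ f '' A) :
    ∃ v, ¬ P v ⊆ A ∧ f '' P v = P w := by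
  obtain ⟨-, ⟨-, G', hG'⟩, hr⟩ := h
  obtain ⟨x, hx, hx'⟩ := hP.core w
  have hxA : x ∉ f '' A := by
    intro hxA
    rw [hG'] at hxA hw
    simp only [mem_iUnion] at hxA
    obtain ⟨u, hu, hxu⟩ := hxA
    rw [hx' u hxu] at hu
    exact hw (subset_biUnion_of_mem (u := P) (Finset.mem_coe.2 hu))
  obtain ⟨v, hv⟩ := hP.cover (f.symm x)
  have hvA : ¬ P v ⊆ A := fun h => hxA ⟨f.symm x, h hv, f.apply_symm_apply x⟩
  obtain ⟨u, hu⟩ := hr v hvA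
  have : x ∈ P u := hu ▸ ⟨f.symm x, hv, f.apply_symm_apply x⟩
  exact ⟨v, hvA, by rw [hu, hx' u this]⟩

/-- The group of asymptotically rigid homeomorphisms. -/
def asymptoticallyRigidHomeo (P : V → Set S) (hP : IsPolygonDecomposition P) :
    Subgroup (S ≃ₜ S) where
  carrier := {f | AsymptoticallyRigid P f}
  one_mem' := by
    obtain ⟨A, hA, -⟩ := hP.extend ∅
    have h1 : ∀ T : Set S, (1 : S ≃ₜ S) '' T = T := fun T => image_id T
    exact ⟨A, hA, (h1 A).symm ▸ hA, fun v _ => ⟨v, h1 _⟩⟩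
  mul_mem' := by
    classical
    rintro g f ⟨B, hB⟩ ⟨A, hA⟩
    obtain ⟨-, K, hK⟩ := hB.1
    have hpre : ∀ w, ∃ v, ¬ P w ⊆ f '' A → f '' P v = P w := by
      intro w
      by_cases hw : P w ⊆ f '' A
      · exact ⟨w, fun h => absurd hw h⟩
      · obtain ⟨v, -, hv⟩ := hA.exists_preimage hP hw
        exact ⟨v, fun _ => hv⟩
    choose τ hτ using hpre
    obtain ⟨A', hA', hAA', hF⟩ := hA.enlarge hP (K.image τ)
    have hBA : B ⊆ f '' A' := by
      rw [hK]
      refine iUnion₂_subset fun w hw => ?_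
      by_cases h : P w ⊆ f '' A
      · exact h.trans (image_mono hAA')
      · rw [← hτ w h]
        exact image_mono (hF _ (Finset.mem_image_of_mem _ hw))
    have hgA : IsSupport P g (f '' A') := hB.mono hA'.2.1 hBA
    refine ⟨A', hA'.1, ?_, fun v hv => ?_⟩
    · have := hgA.2.1
      rwa [← image_comp] at this
    · obtain ⟨w, hw⟩ := hA'.2.2 v hv
      have hw' : ¬ P w ⊆ f '' A' := by
        rw [← hw]
        exact fun h => hv ((image_subset_image_iff f.injective).1 h)
      obtain ⟨u, hu⟩ := hgA.2.2 w hw'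
      exact ⟨u, by rw [← hu, ← hw, ← image_comp]; rfl⟩
  inv_mem' := by
    rintro f ⟨A, hA⟩
    have hinv : ∀ T : Set S, (f⁻¹ : S ≃ₜ S) '' (f '' T) = T := by
      intro T
      rw [← image_comp]
      convert image_id T using 2
      exact f.symm_apply_apply _
    refine ⟨f '' A, hA.2.1, by rw [hinv]; exact hA.1, fun w hw => ?_⟩
    obtain ⟨v, -, hv⟩ := hA.exists_preimage hP hw
    exact ⟨v, by rw [← hv, hinv]⟩

end Rigid

/-! ### The polygons of the model form a polygon decomposition -/

section Model

variable {n m : ℕ}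

theorem width_pos (l : List (Fin n)) : 0 < width n m l := by
  unfold width; positivity

theorem width_cons (j : Fin n) (l : List (Fin n)) :
    width n m l = (2 * n + 1) * width n m (j :: l) := by
  unfold width
  rw [List.length_cons, pow_succ]
  field_simp

theorem node_interval {i : Fin m} {l : List (Fin n)} {z : ℂ}
    (hz : z ∈ closedPolygon n m (.node i l)) :
    left n m i l ≤ z.re ∧ z.re ≤ left n m i l + width n m l := by
  obtain ⟨h1, -, h3, h4⟩ := hz
  have h : 0 ≤ (z.im - l.length) * width n m l :=
    mul_nonneg (by linarith) (width_pos l).le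
  have hn : (0 : ℝ) < 2 * n + 2 := by positivity
  constructor
  · by_contra! hc
    nlinarith
  · by_contra! hc
    nlinarith

theorem odd_intervals {a b : ℕ} {x : ℝ} (ha : (2 * a + 1 : ℝ) ≤ x) (ha' : x ≤ 2 * a + 2)
    (hb : (2 * b + 1 : ℝ) ≤ x) (hb' : x ≤ 2 * b + 2) : a = b := by
  have h1 : 2 * a + 1 ≤ 2 * b + 2 := by exact_mod_cast ha.trans hb'
  have h2 : 2 * b + 1 ≤ 2 * a + 2 := by exact_mod_cast hb.trans ha'
  omega

theorem child_interval {i : Fin m} {j : Fin n} {l : List (Fin n)} {x : ℝ}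
    (h1 : left n m i (j :: l) ≤ x) (h2 : x ≤ left n m i (j :: l) + width n m (j :: l)) :
    left n m i l ≤ x ∧ x ≤ left n m i l + width n m l := by
  have hw := width_pos (m := m) (j :: l)
  have hj : ((j : ℕ) : ℝ) + 1 ≤ n := by exact_mod_cast j.2
  rw [width_cons j l]
  unfold left at h1 h2
  constructor
  · have : 0 ≤ (2 * ((j : ℕ) : ℝ) + 1) * width n m (j :: l) := by positivity
    linarith
  · nlinarith

/-- Polygons at the same height lie over disjoint intervals. -/
theorem interval_unique {i i' : Fin m} : ∀ {l l' : List (Fin n)} {x : ℝ}, l.length = l'.length →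
    left n m i l ≤ x → x ≤ left n m i l + width n m l →
    left n m i' l' ≤ x → x ≤ left n m i' l' + width n m l' → i = i' ∧ l = l'
  | [], [], x, _, h1, h2, h3, h4 => by
    have hm : (0 : ℝ) < 2 * m + 1 := by positivity
    simp only [left, width, List.length_nil, pow_zero, mul_one, ← add_div] at h1 h2 h3 h4
    rw [div_le_iff₀ hm] at h1 h3
    rw [le_div_iff₀ hm] at h2 h4
    exact ⟨Fin.ext (odd_intervals h1 (by linarith) h3 (by linarith)), rfl⟩
  | j :: l, j' :: l', x, h, h1, h2, h3, h4 => by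
    have hl : l.length = l'.length := by simpa using h
    obtain ⟨p1, p2⟩ := child_interval h1 h2
    obtain ⟨p3, p4⟩ := child_interval h3 h4
    obtain ⟨rfl, rfl⟩ := interval_unique hl p1 p2 p3 p4
    have hw := width_pos (m := m) (j :: l)
    have hww : width n m (j' :: l) = width n m (j :: l) := by simp [width]
    simp only [left, hww] at h1 h2 h3 h4
    have e : x = left n m i l + (x - left n m i l) / width n m (j :: l) * width n m (j :: l) := by
      field_simp; ring
    set y := (x - left n m i l) / width n m (j :: l)
    rw [e] at h1 h2 h3 h4
    have := odd_intervals (a := j) (b := j') (x := y)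
      (by by_contra! hc; nlinarith) (by by_contra! hc; nlinarith)
      (by by_contra! hc; nlinarith) (by by_contra! hc; nlinarith)
    exact ⟨rfl, by rw [Fin.ext this]⟩

/-- A point on the vertical axis of a polygon, at relative height `t`. -/
noncomputable def axisPoint (n m : ℕ) (t : ℝ) : Vertex n m → ℂ
  | .root => ⟨1 / 2, -1 + t⟩
  | .node i l => ⟨left n m i l + width n m l / 2, l.length + t⟩

theorem axisPoint_half (v : Vertex n m) : axisPoint n m (1 / 2) v = vertexPoint n m v := by
  cases v <;> apply Complex.ext <;> norm_num [axisPoint, vertexPoint]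

theorem axisPoint_mem {t : ℝ} (h0 : 0 ≤ t) (h1 : t ≤ 1) (v : Vertex n m) :
    axisPoint n m t v ∈ closedPolygon n m v := by
  cases v with
  | root => refine ⟨?_, ?_, ?_, ?_⟩ <;> simp only [axisPoint] <;> linarith
  | node i l =>
    have hw := width_pos (m := m) l
    have hn : (0 : ℝ) ≤ n := by positivity
    refine ⟨?_, ?_, ?_, ?_⟩ <;> simp only [axisPoint]
    · linarith
    · linarith
    · nlinarith [mul_nonneg hn hw.le]
    · nlinarith [mul_nonneg hn hw.le]

theorem axisPoint_unique {t : ℝ} (h0 : 0 < t) (h1 : t < 1) {v w : Vertex n m}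
    (h : axisPoint n m t v ∈ closedPolygon n m w) : w = v := by
  have len : ∀ a b : ℕ, (a : ℝ) ≤ b + t → (b : ℝ) + t ≤ a + 1 → a = b := by
    intro a b ha hb
    have h2 : (a : ℝ) < (b + 1 : ℕ) := by push_cast; linarith
    have h3 : (b : ℝ) < (a + 1 : ℕ) := by push_cast; linarith
    have h2 : a < b + 1 := by exact_mod_cast h2
    have h3 : b < a + 1 := by exact_mod_cast h3
    omega
  cases v with
  | root =>
    cases w with
    | root => rfl
    | node i l =>
      have h2 := h.1
      simp only [axisPoint] at h2
      have : (0 : ℝ) ≤ l.length := by positivity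
      linarith
  | node i l =>
    cases w with
    | root =>
      have h2 := h.2.2.2
      simp only [axisPoint] at h2
      have : (0 : ℝ) ≤ l.length := by positivity
      linarith
    | node i' l' =>
      obtain ⟨h3, h4⟩ := node_interval h
      have e := len _ _ h.1 h.2.1
      have hw := width_pos (m := m) l
      simp only [axisPoint] at h3 h4
      obtain ⟨rfl, rfl⟩ := interval_unique (i := i) (i' := i') e.symm (by linarith) (by linarith)
        h3 h4
      rfl

theorem vertexPoint_ne_axisPoint {t : ℝ} (h0 : 0 < t) (h1 : t < 1) (ht : t ≠ 1 / 2)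
    (v w : Vertex n m) : vertexPoint n m w ≠ axisPoint n m t v := by
  intro h
  have h' := axisPoint_mem (n := n) (m := m) (t := 1 / 2) (by norm_num) (by norm_num) w
  rw [axisPoint_half, h] at h'
  obtain rfl := axisPoint_unique h0 h1 h'
  have := congrArg Complex.im h
  cases w <;> simp only [axisPoint, vertexPoint] at this <;> apply ht <;> linarith

theorem convex_closedPolygon (v : Vertex n m) : Convex ℝ (closedPolygon n m v) := by
  intro x hx y hy a b ha hb hab
  have hb' : b = 1 - a := by linarith
  subst hb'
  cases v with
  | root =>
    obtain ⟨x1, x2, x3, x4⟩ := hx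
    obtain ⟨y1, y2, y3, y4⟩ := hy
    refine ⟨?_, ?_, ?_, ?_⟩ <;>
      simp only [Complex.add_re, Complex.add_im, Complex.smul_re, Complex.smul_im, smul_eq_mul] <;>
      nlinarith
  | node i l =>
    obtain ⟨x1, x2, x3, x4⟩ := hx
    obtain ⟨y1, y2, y3, y4⟩ := hy
    have k3 := add_le_add (mul_le_mul_of_nonneg_left x3 ha) (mul_le_mul_of_nonneg_left y3 hb)
    have k4 := add_le_add (mul_le_mul_of_nonneg_left x4 ha) (mul_le_mul_of_nonneg_left y4 hb)
    refine ⟨?_, ?_, ?_, ?_⟩ <;>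
      simp only [Complex.add_re, Complex.add_im, Complex.smul_re, Complex.smul_im, smul_eq_mul]
    · nlinarith
    · nlinarith
    · linarith
    · linarith

/-- A convex region of the plane minus a point `c` all of whose four diagonal directions stay in the
region is connected. -/
theorem isPreconnected_diff_point {K : Set ℂ} (hK : Convex ℝ K) {c : ℂ} {a b : ℝ} (ha : 0 < a)
    (hb : 0 < b) (h : ∀ s ∈ ({1, -1} : Set ℝ), ∀ r ∈ ({1, -1} : Set ℝ),
      (⟨c.re + s * a, c.im + r * b⟩ : ℂ) ∈ K) : IsPreconnected (K \ {c}) := by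
  have hR : Convex ℝ (K ∩ {z : ℂ | c.re < z.re}) := hK.inter (convex_halfSpace_re_gt _)
  have hL : Convex ℝ (K ∩ {z : ℂ | z.re < c.re}) := hK.inter (convex_halfSpace_re_lt _)
  have hU : Convex ℝ (K ∩ {z : ℂ | c.im < z.im}) := hK.inter (convex_halfSpace_im_gt _)
  have hD : Convex ℝ (K ∩ {z : ℂ | z.im < c.im}) := hK.inter (convex_halfSpace_im_lt _)
  have hpp := h 1 (by simp) 1 (by simp)
  have hpm := h 1 (by simp) (-1) (by simp)
  have hmp := h (-1) (by simp) 1 (by simp)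
  have h1 := hR.isPreconnected.union (⟨c.re + 1 * a, c.im + 1 * b⟩ : ℂ)
    (mem_inter hpp (by simpa using ha)) (mem_inter hpp (by simpa using hb)) hU.isPreconnected
  have h2 := h1.union (⟨c.re + -1 * a, c.im + 1 * b⟩ : ℂ)
    (Or.inr (mem_inter hmp (by simpa using hb))) (mem_inter hmp (by simpa using ha))
    hL.isPreconnected
  have h3 := h2.union (⟨c.re + 1 * a, c.im + -1 * b⟩ : ℂ)
    (Or.inl (Or.inl (mem_inter hpm (by simpa using ha)))) (mem_inter hpm (by simpa using hb))
    hD.isPreconnected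
  convert h3 using 1
  ext z
  simp only [mem_sdiff, mem_singleton_iff, mem_union, mem_inter_iff, mem_ofPred_eq, Complex.ext_iff]
  constructor
  · rintro ⟨hz, hne⟩
    rcases lt_trichotomy z.re c.re with hr | hr | hr
    · tauto
    · rcases lt_trichotomy z.im c.im with hi | hi | hi <;> tauto
    · tauto
  · rintro (((⟨hz, hr⟩ | ⟨hz, hr⟩) | ⟨hz, hr⟩) | ⟨hz, hr⟩) <;>
      exact ⟨hz, fun hc => by linarith [hc.1, hc.2]⟩

theorem isPreconnected_polygon (X : Set (Vertex n m)) (v : Vertex n m) :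
    IsPreconnected (polygon n m X v) := by
  rw [← Topology.IsInducing.subtypeVal.isPreconnected_image]
  have himg : (Subtype.val '' polygon n m X v : Set ℂ) =
      closedPolygon n m v \ (vertexPoint n m '' X) := by
    rw [polygon, Subtype.image_preimage_coe]
    ext z
    simp only [surface, mem_inter_iff, mem_sdiff, mem_iUnion]
    tauto
  rw [himg]
  have hp : ∀ w ∈ X, vertexPoint n m w ∈ closedPolygon n m v → w = v := by
    intro w _ hw
    rw [← axisPoint_half] at hw
    exact (axisPoint_unique (by norm_num) (by norm_num) hw).symm
  by_cases hv : v ∈ X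
  · have : closedPolygon n m v \ (vertexPoint n m '' X) =
        closedPolygon n m v \ {vertexPoint n m v} := by
      ext z
      simp only [mem_sdiff, mem_image, mem_singleton_iff]
      constructor
      · rintro ⟨hz, h⟩
        exact ⟨hz, fun hc => h ⟨v, hv, hc.symm⟩⟩
      · rintro ⟨hz, h⟩
        refine ⟨hz, ?_⟩
        rintro ⟨w, hw, rfl⟩
        exact h (by rw [hp w hw hz])
    rw [this]
    cases v with
    | root =>
      refine isPreconnected_diff_point (a := 1 / 4) (b := 1 / 4) (convex_closedPolygon _)
        (by norm_num) (by norm_num) ?_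
      rintro s (rfl | rfl) r (rfl | rfl) <;> norm_num [closedPolygon, vertexPoint]
    | node i l =>
      have hw := width_pos (m := m) l
      have hn : (0 : ℝ) ≤ n := by positivity
      have hnw := mul_nonneg hn hw.le
      refine isPreconnected_diff_point (a := width n m l / 8) (b := 1 / 8)
        (convex_closedPolygon _) (by linarith) (by norm_num) ?_
      rintro s (rfl | rfl) r (rfl | rfl) <;> refine ⟨?_, ?_, ?_, ?_⟩ <;>
        simp only [vertexPoint] <;> nlinarith
  · have : closedPolygon n m v \ (vertexPoint n m '' X) = closedPolygon n m v := by
      refine sdiff_eq_left.2 (disjoint_left.2 ?_)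
      rintro _ hz ⟨w, hw, rfl⟩
      exact hv (hp w hw hz ▸ hw)
    rw [this]
    exact (convex_closedPolygon v).isPreconnected

/-- The vertices on the path of the tree from the centre to a given vertex. -/
def ancestors : Vertex n m → List (Vertex n m)
  | .root => [.root]
  | .node i [] => [.node i [], .root]
  | .node i (j :: l) => .node i (j :: l) :: ancestors (.node i l)

/-- The middle of the arc below a noncentral vertex belongs to the two adjacent polygons. -/
theorem isChild_inter {v w : Vertex n m} (X : Set (Vertex n m)) (h : IsChild v w) :
    ∃ x, x ∈ polygon n m X v ∧ x ∈ polygon n m X w := by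
  have key : axisPoint n m 0 w ∈ closedPolygon n m v := by
    cases h with
    | ofRoot i =>
      have hi : ((i : ℕ) : ℝ) + 1 ≤ m := by exact_mod_cast i.2
      have hm : (0 : ℝ) < 2 * m + 1 := by positivity
      have e : left n m i [] + width n m [] / 2 = (2 * (i : ℕ) + 3 / 2) / (2 * m + 1) := by
        simp only [left, width, List.length_nil]
        field_simp
        ring
      refine ⟨?_, ?_, ?_, ?_⟩ <;> simp only [axisPoint, List.length_nil]
      · rw [e]; positivity
      · rw [e, div_le_one hm]; linarith
      · norm_num
      · norm_num
    | ofNode i j l =>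
      have hj : ((j : ℕ) : ℝ) + 1 ≤ n := by exact_mod_cast j.2
      have hw := width_pos (m := m) (j :: l)
      have hj0 : (0 : ℝ) ≤ (j : ℕ) := by positivity
      have e : (2 * (n : ℝ) + 2) * ((2 * ((j : ℕ) : ℝ) + 3 / 2)) ≥ 2 * n + 1 := by nlinarith
      have e' : (2 * (n : ℝ) + 2) * (2 * n + 1 - (2 * ((j : ℕ) : ℝ) + 3 / 2)) ≥ 2 * n + 1 := by
        nlinarith
      have f := mul_le_mul_of_nonneg_right e.le hw.le
      have f' := mul_le_mul_of_nonneg_right e'.le hw.le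
      refine ⟨?_, ?_, ?_, ?_⟩ <;> simp only [axisPoint, List.length_cons] <;> push_cast
      · linarith
      · linarith
      · rw [width_cons j l, left]; nlinarith
      · rw [width_cons j l, left]; nlinarith
  have hint : ∃ k : ℕ, (axisPoint n m 0 w).im = k := by
    cases h with
    | ofRoot i => exact ⟨0, by simp [axisPoint]⟩
    | ofNode i j l => exact ⟨(j :: l).length, by simp [axisPoint]⟩
  have hnot : axisPoint n m 0 w ∉ vertexPoint n m '' X := by
    rintro ⟨u, -, hu⟩
    obtain ⟨k, hk⟩ := hint
    rw [← hu] at hk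
    cases u with
    | root =>
      simp only [vertexPoint] at hk
      have : (0 : ℝ) ≤ k := by positivity
      linarith
    | node i l =>
      simp only [vertexPoint] at hk
      have : ((2 * l.length + 1 : ℕ) : ℝ) = (2 * k : ℕ) := by push_cast; linarith
      have : 2 * l.length + 1 = 2 * k := by exact_mod_cast this
      omega
  exact ⟨⟨axisPoint n m 0 w, mem_iUnion.2 ⟨v, key⟩, hnot⟩, key,
    axisPoint_mem le_rfl zero_le_one w⟩

theorem ancestors_self (v : Vertex n m) : v ∈ ancestors v := by
  rcases v with _ | ⟨i, _ | ⟨j, l⟩⟩ <;> simp [ancestors]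

theorem root_ancestors : ∀ v : Vertex n m, .root ∈ ancestors v
  | .root => by simp [ancestors]
  | .node i [] => by simp [ancestors]
  | .node i (j :: l) => by simp [ancestors, root_ancestors (.node i l)]

theorem isPreconnected_ancestors (X : Set (Vertex n m)) :
    ∀ v : Vertex n m, IsPreconnected (⋃ w ∈ ancestors v, polygon n m X w)
  | .root => by simpa [ancestors] using isPreconnected_polygon X .root
  | .node i [] => by
    obtain ⟨x, hx, hx'⟩ := isChild_inter X (IsChild.ofRoot (n := n) i)
    simpa [ancestors, iUnion_or, iUnion_union_distrib] using
      (isPreconnected_polygon X (.node i [])).union x hx' hx (isPreconnected_polygon X .root)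
  | .node i (j :: l) => by
    obtain ⟨x, hx, hx'⟩ := isChild_inter X (IsChild.ofNode i j l)
    have := (isPreconnected_polygon X (.node i (j :: l))).union x hx'
      (mem_iUnion₂.2 ⟨_, ancestors_self _, hx⟩) (isPreconnected_ancestors X (.node i l))
    simpa [ancestors, iUnion_or, iUnion_union_distrib] using this

theorem isPolygonDecomposition (n m : ℕ) (X : Set (Vertex n m)) :
    IsPolygonDecomposition (polygon n m X) where
  cover := by
    rintro ⟨x, hx, hx'⟩
    obtain ⟨v, hv⟩ := mem_iUnion.1 hx
    exact ⟨v, hv⟩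
  core := by
    intro v
    refine ⟨⟨axisPoint n m (1 / 4) v, mem_iUnion.2 ⟨v, ?_⟩, ?_⟩, ?_, ?_⟩
    · exact axisPoint_mem (by norm_num) (by norm_num) v
    · rintro ⟨w, -, hw⟩
      exact vertexPoint_ne_axisPoint (by norm_num) (by norm_num) (by norm_num) v w hw
    · exact axisPoint_mem (t := 1 / 4) (by norm_num) (by norm_num) v
    · intro w hw
      exact axisPoint_unique (t := 1 / 4) (by norm_num) (by norm_num) hw
  extend := by
    classical
    intro F
    have hroot : (axisPoint n m (1 / 4) .root) ∈ surface n m X := by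
      refine ⟨mem_iUnion.2 ⟨.root, axisPoint_mem (by norm_num) (by norm_num) _⟩, ?_⟩
      rintro ⟨w, -, hw⟩
      exact vertexPoint_ne_axisPoint (by norm_num) (by norm_num) (by norm_num) _ w hw
    have hmem : (⟨_, hroot⟩ : surface n m X) ∈ polygon n m X .root :=
      axisPoint_mem (t := 1 / 4) (by norm_num) (by norm_num) (Vertex.root : Vertex n m)
    refine ⟨(⋃ v ∈ insert Vertex.root F, ⋃ w ∈ ancestors v, polygon n m X w), ⟨⟨⟨⟨_, hroot⟩, ?_⟩, ?_⟩,
      (insert Vertex.root F).biUnion fun v => (ancestors v).toFinset, ?_⟩, fun v hv => ?_⟩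
    · exact mem_iUnion₂.2 ⟨.root, Finset.mem_insert_self _ _,
        mem_iUnion₂.2 ⟨.root, root_ancestors _, hmem⟩⟩
    · have : (⋃ v ∈ insert Vertex.root F, ⋃ w ∈ ancestors v, polygon n m X w) =
          ⋃₀ ((fun v => ⋃ w ∈ ancestors v, polygon n m X w) ''
            ((insert Vertex.root F : Finset (Vertex n m)) : Set (Vertex n m))) := by
        rw [sUnion_image]; rfl
      rw [this]
      refine isPreconnected_sUnion ⟨_, hroot⟩ _ ?_ ?_
      · rintro _ ⟨v, -, rfl⟩
        exact mem_iUnion₂.2 ⟨.root, root_ancestors _, hmem⟩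
      · rintro _ ⟨v, -, rfl⟩
        exact isPreconnected_ancestors X v
    · ext x
      simp only [mem_iUnion, Finset.mem_biUnion, List.mem_toFinset]
      constructor
      · rintro ⟨v, hv, w, hw, hx⟩
        exact ⟨w, ⟨v, hv, hw⟩, hx⟩
      · rintro ⟨w, ⟨v, hv, hw⟩, hx⟩
        exact ⟨v, hv, w, hw, hx⟩
    · intro x hx
      exact mem_iUnion₂.2 ⟨v, Finset.mem_insert_of_mem hv,
        mem_iUnion₂.2 ⟨v, ancestors_self v, hx⟩⟩

end Model

/-! ### Asymptotically rigid mapping class groups -/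

/-- The group of orientation-preserving asymptotically rigid homeomorphisms of the arboreal surface
of `A_{n,m}` punctured at the vertices in `X`, for the rigid structure given by the polygons. -/
noncomputable def rigidHomeo (n m : ℕ) (X : Set (Vertex n m)) : Subgroup (surface n m X ≃ₜ surface n m X) :=
  homeoPlus (surface n m X) ⊓
    asymptoticallyRigidHomeo (polygon n m X) (isPolygonDecomposition n m X)

/-- The asymptotically rigid mapping class group: isotopy classes of orientation-preserving
asymptotically rigid homeomorphisms. -/
abbrev amod (n m : ℕ) (X : Set (Vertex n m)) : Type :=
  rigidHomeo n m X ⧸ (isotopicToId (surface n m X)).subgroupOf (rigidHomeo n m X)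

/-- The homeomorphism `ψ` from `𝒮^♯(A_{n,m})` to `𝒮^*(A_{n,k})` identifies the rigid structures after
merging, in the second one, the central polygon with the polygon of `b`: it sends the central polygon
to the union of these two, and matches the other polygons bijectively. -/
def IdentifiesAfterMerging {n m k : ℕ} (ψ : surface n m (sharp n m) ≃ₜ surface n k (star n k))
    (b : Vertex n k) : Prop :=
  ψ '' polygon n m (sharp n m) .root =
      polygon n k (star n k) .root ∪ polygon n k (star n k) b ∧
    ∃ e : {v : Vertex n m // v ≠ .root} ≃ {w : Vertex n k // w ≠ .root ∧ w ≠ b},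
      ∀ v, ψ '' polygon n m (sharp n m) v.1 = polygon n k (star n k) (e v).1

end ArborealSurface

/-!
The homeomorphism `ψ` is the restriction of an explicit homeomorphism of the plane. Write `m = n + r`,
so that `m - n + 1 = r + 1`, and take for `b` the leftmost neighbour `node 0 []` of the centre. In
`A_{n,r+1}`, the union of the central polygon and the polygon of `b` is the region
`0 ≤ x ≤ 1`, `-1 ≤ y ≤ roof n r x`, and `n + r` branches are attached to it: the `n` branches of the
children of `b`, one unit higher, followed by `r` branches of neighbours of the centre. The central
rectangle of `A_{n,n+r}` carries the same number of branches in the same order. A horizontal shear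
`slide` carries their feet to the right abscissas, affinely on each branch, and at the lower height
`-1 / 2` carries the central puncture to the vertical axis of the polygon of `b`; a vertical shear
`lift` then raises the top side of the rectangle to the graph of `roof`, translates the branches, and
carries the puncture to the vertex `b`. On each branch the composition is an affine change of abscissa
and a vertical translation, so polygons and their centres go to polygons and their centres
(`exists_homeomorph_plane`).

A shear turns no vector `z - w` by a half turn. Hence the principal logarithm of
`(e z - e w) / (z - w)` is continuous, and shears preserve winding numbers (`NoHalfTurn.hasWinding`);
so `ψ` conjugates orientation-preserving homeomorphisms to orientation-preserving ones.

Asymptotic rigidity is insensitive to the merging (`MatchesOff.asymptoticallyRigid`): the support of an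
asymptotically rigid homeomorphism can be enlarged until the support and its image both contain the
polygons that are merged, and outside it the two rigid structures coincide. The hypotheses of this
argument are symmetric in the two surfaces, so conjugation by `ψ` is an isomorphism between the groups
of homeomorphisms, and it respects isotopy (`exists_amod_mulEquiv`).
-/

namespace ArborealSurface

/-! ### Transport of groups of homeomorphisms by conjugation -/

/-- Conjugation by a homeomorphism, as an isomorphism between groups of homeomorphisms. -/
def conjHomeo {S T : Type*} [TopologicalSpace S] [TopologicalSpace T] (ψ : S ≃ₜ T) :
    (S ≃ₜ S) ≃* (T ≃ₜ T) where
  toFun f := (ψ.symm.trans f).trans ψ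
  invFun g := (ψ.trans g).trans ψ.symm
  left_inv f := by ext; simp
  right_inv g := by ext; simp
  map_mul' f g := by ext; simp

section

variable {S T V W : Type*} [TopologicalSpace S] [TopologicalSpace T]

@[simp] theorem conjHomeo_apply (ψ : S ≃ₜ T) (f : S ≃ₜ S) (x : T) :
    conjHomeo ψ f x = ψ (f (ψ.symm x)) := rfl

theorem conjHomeo_image (ψ : S ≃ₜ T) (f : S ≃ₜ S) (A : Set S) :
    conjHomeo ψ f '' (ψ '' A) = ψ '' (f '' A) := by
  simp only [image_image, conjHomeo_apply, ψ.symm_apply_apply]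

theorem conjHomeo_mem_isotopicToId (ψ : S ≃ₜ T) {f : S ≃ₜ S} (hf : f ∈ isotopicToId S) :
    conjHomeo ψ f ∈ isotopicToId T := by
  obtain ⟨H, hH, hh, h0, h1⟩ := hf
  refine ⟨fun p => ψ (H (p.1, ψ.symm p.2)), by fun_prop, fun t =>
    ψ.isHomeomorph.comp ((hh t).comp ψ.symm.isHomeomorph), fun x => ?_, fun x => ?_⟩
  · simp [h0]
  · simp [h1]

/-- Two families of sets correspond to each other under `ψ` off the finite sets of indices `K` and
`K'`, and the unions of the sets indexed by `K` and `K'` correspond to each other. -/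
structure MatchesOff (ψ : S ≃ₜ T) (P : V → Set S) (Q : W → Set T) (K : Finset V) (K' : Finset W) :
    Prop where
  merged : ψ '' (⋃ v ∈ K, P v) = ⋃ w ∈ K', Q w
  forth : ∀ v ∉ K, ∃ w ∉ K', ψ '' P v = Q w
  back : ∀ w ∉ K', ∃ v ∉ K, ψ '' P v = Q w

variable {P : V → Set S} {Q : W → Set T} {K : Finset V} {K' : Finset W} {ψ : S ≃ₜ T}

theorem MatchesOff.symm (h : MatchesOff ψ P Q K K') : MatchesOff ψ.symm Q P K' K where
  merged := by rw [← h.merged]; exact ψ.toEquiv.symm_image_image _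
  forth w hw := by
    obtain ⟨v, hv, e⟩ := h.back w hw
    exact ⟨v, hv, by rw [← e]; exact ψ.toEquiv.symm_image_image _⟩
  back v hv := by
    obtain ⟨w, hw, e⟩ := h.forth v hv
    exact ⟨w, hw, by rw [← e]; exact ψ.toEquiv.symm_image_image _⟩

theorem MatchesOff.admissible_image (h : MatchesOff ψ P Q K K') {A : Set S} (hA : Admissible P A)
    (hK : ∀ v ∈ K, P v ⊆ A) : Admissible Q (ψ '' A) := by
  classical
  obtain ⟨hc, F, hF⟩ := hA
  refine ⟨hc.image _ ψ.continuous.continuousOn, ?_⟩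
  choose τ hτ hτ' using h.forth
  refine ⟨K' ∪ Finset.image (fun v : {v // v ∈ F.filter (· ∉ K)} =>
    τ v.1 (Finset.mem_filter.1 v.2).2) (F.filter (· ∉ K)).attach, ?_⟩
  have hAF : A = (⋃ v ∈ K, P v) ∪ ⋃ v ∈ F.filter (· ∉ K), P v := by
    apply Subset.antisymm
    · intro x hx
      rw [hF] at hx
      obtain ⟨v, hv, hxv⟩ := mem_iUnion₂.1 hx
      by_cases hvK : v ∈ K
      · exact Or.inl (mem_iUnion₂.2 ⟨v, hvK, hxv⟩)
      · exact Or.inr (mem_iUnion₂.2 ⟨v, Finset.mem_filter.2 ⟨hv, hvK⟩, hxv⟩)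
    · refine union_subset (iUnion₂_subset hK) (iUnion₂_subset fun v hv => ?_)
      rw [hF]
      exact subset_biUnion_of_mem (u := P) (Finset.mem_coe.2 (Finset.mem_filter.1 hv).1)
  rw [hAF, image_union, h.merged, Finset.set_biUnion_union, Finset.set_biUnion_finset_image,
    image_iUnion₂]
  congr 1
  simp only [← hτ']
  ext x
  simp

/-- A support can be enlarged so that both it and its image contain finitely many given polygons. -/
theorem IsSupport.enlarge_both (hP : IsPolygonDecomposition P) {f : S ≃ₜ S} {A : Set S}
    (h : IsSupport P f A) (F : Finset V) :
    ∃ B, IsSupport P f B ∧ (∀ v ∈ F, P v ⊆ B) ∧ ∀ v ∈ F, P v ⊆ f '' B := by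
  classical
  have hpre : ∀ w, ∃ v, ¬ P w ⊆ f '' A → f '' P v = P w := by
    intro w
    by_cases hw : P w ⊆ f '' A
    · exact ⟨w, fun h => absurd hw h⟩
    · obtain ⟨v, -, hv⟩ := h.exists_preimage hP hw
      exact ⟨v, fun _ => hv⟩
  choose τ hτ using hpre
  obtain ⟨B, hB, hAB, hF⟩ := h.enlarge hP (F ∪ F.image τ)
  refine ⟨B, hB, fun v hv => hF v (Finset.mem_union_left _ hv), fun v hv => ?_⟩
  by_cases hvA : P v ⊆ f '' A
  · exact hvA.trans (image_mono hAB)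
  · rw [← hτ v hvA]
    exact image_mono (hF _ (Finset.mem_union_right _ (Finset.mem_image_of_mem _ hv)))

/-- Asymptotic rigidity only depends on the rigid structure up to merging finitely many polygons. -/
theorem MatchesOff.asymptoticallyRigid (h : MatchesOff ψ P Q K K') (hP : IsPolygonDecomposition P)
    {f : S ≃ₜ S} (hf : AsymptoticallyRigid P f) : AsymptoticallyRigid Q (conjHomeo ψ f) := by
  obtain ⟨A₀, hA₀⟩ := hf
  obtain ⟨A, hA, hK, hfK⟩ := hA₀.enlarge_both hP K
  refine ⟨ψ '' A, h.admissible_image hA.1 hK, ?_, fun w hw => ?_⟩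
  · rw [conjHomeo_image]
    exact h.admissible_image hA.2.1 hfK
  · have hwK : w ∉ K' := fun hwK => hw <|
      (subset_biUnion_of_mem (u := Q) (Finset.mem_coe.2 hwK)).trans
        (h.merged.symm.subset.trans (image_mono (iUnion₂_subset hK)))
    obtain ⟨v, -, hvw⟩ := h.back w hwK
    have hv : ¬ P v ⊆ A := fun hv => hw (hvw ▸ image_mono hv)
    obtain ⟨u, hu⟩ := hA.2.2 v hv
    have huK : u ∉ K := fun huK =>
      hv ((image_subset_image_iff f.injective).1 (hu ▸ hfK u huK))
    obtain ⟨w', -, hw'⟩ := h.forth u huK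
    exact ⟨w', by rw [← hvw, conjHomeo_image, hu, hw']⟩

end

/-- The homeomorphism `ψ` between subsets of the plane preserves winding numbers of closed
curves around points. -/
def PreservesWinding {S T : Set ℂ} (ψ : S ≃ₜ T) : Prop :=
  ∀ (γ : Circle → S) (p : S) (k : ℤ),
    HasWinding (fun t => (γ t : ℂ)) p k ↔ HasWinding (fun t => (ψ (γ t) : ℂ)) (ψ p) k

theorem PreservesWinding.symm {S T : Set ℂ} {ψ : S ≃ₜ T} (h : PreservesWinding ψ) :
    PreservesWinding ψ.symm := fun γ p k => by
  simpa using (h (fun t => ψ.symm (γ t)) (ψ.symm p) k).symm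

theorem PreservesWinding.orientationPreserving {S T : Set ℂ} {ψ : S ≃ₜ T}
    (h : PreservesWinding ψ) {f : S ≃ₜ S} (hf : OrientationPreserving f) :
    OrientationPreserving (conjHomeo ψ f) := fun γ hγ p k =>
  (h.symm γ p k).trans <|
    (hf ((ψ.symm : C(T, S)).comp γ) (hγ.comp_right _) (ψ.symm p) k).trans
      (h (fun t => f (ψ.symm (γ t))) (f (ψ.symm p)) k)

/-! ### Shears of the plane -/

/-- A map of the plane that preserves the second coordinate and stretches every horizontal line at
least by the factor `δ` is a homeomorphism. -/
theorem exists_homeomorph_shear {h : ℝ → ℝ → ℝ} (hc : Continuous fun p : ℝ × ℝ => h p.1 p.2)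
    {δ : ℝ} (hδ : 0 < δ) (hs : ∀ y x x', x ≤ x' → δ * (x' - x) ≤ h x' y - h x y)
    {C : ℝ} (hC : ∀ y, |h 0 y| ≤ C) :
    ∃ e : ℝ × ℝ ≃ₜ ℝ × ℝ, ∀ p, e p = (h p.1 p.2, p.2) := by
  have hinj : ∀ y x x', h x y = h x' y → x = x' := by
    intro y x x' e
    rcases le_total x x' with hx | hx
    · nlinarith [hs y _ _ hx]
    · nlinarith [hs y _ _ hx]
  have hsurj : ∀ y, Function.Surjective fun x => h x y := by
    intro y
    have hC' := abs_le.1 (hC y)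
    have hcy : Continuous fun x => h x y := by
      exact hc.comp (Continuous.prodMk_left y)
    refine hcy.surjective ?_ ?_
    · refine Filter.tendsto_atTop_mono' _ (f₁ := fun x => δ * x - C) ?_ ?_
      · filter_upwards [Filter.eventually_ge_atTop 0] with x hx
        linarith [hs y _ _ hx]
      · exact Filter.tendsto_atTop_add_const_right _ _
          (Filter.tendsto_id.const_mul_atTop hδ)
    · refine Filter.tendsto_atBot_mono' _ (?_ : _ ≤ᶠ[_] fun x => δ * x + C) ?_
      · filter_upwards [Filter.eventually_le_atBot 0] with x hx
        linarith [hs y _ _ hx]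
      · exact Filter.tendsto_atBot_add_const_right _ _
          (Filter.tendsto_id.const_mul_atBot hδ)
  let f : ℝ × ℝ → ℝ × ℝ := fun p => (h p.1 p.2, p.2)
  have hf : Continuous f := hc.prodMk continuous_snd
  have hbij : Function.Bijective f := by
    constructor
    · rintro ⟨x, y⟩ ⟨x', y'⟩ e
      obtain ⟨e1, rfl⟩ := Prod.mk.inj e
      exact Prod.ext (hinj _ _ _ e1) rfl
    · rintro ⟨u, y⟩
      obtain ⟨x, hx⟩ := hsurj y u
      exact ⟨(x, y), Prod.ext hx rfl⟩
  have hproper : IsProperMap f := by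
    refine isProperMap_iff_isCompact_preimage.2 ⟨hf, fun K hK => ?_⟩
    obtain ⟨R, hR⟩ := hK.isBounded.exists_norm_le
    refine Metric.isCompact_of_isClosed_isBounded (hK.isClosed.preimage hf)
      (isBounded_iff_forall_norm_le.2 ⟨max R ((R + C) / δ), fun p hp => ?_⟩)
    have hp' := hR _ hp
    rw [Prod.norm_def, max_le_iff, Real.norm_eq_abs, Real.norm_eq_abs] at hp'
    refine (Prod.norm_def p).trans_le (max_le ?_ (hp'.2.trans (le_max_left _ _)))
    refine le_trans ?_ (le_max_right _ _)
    have hC' := abs_le.1 (hC p.2)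
    have hR' := abs_le.1 hp'.1
    rw [Real.norm_eq_abs, le_div_iff₀ hδ]
    rcases le_total 0 p.1 with hx | hx
    · rw [abs_of_nonneg hx]
      linarith [hs p.2 _ _ hx, hR'.2]
    · rw [abs_of_nonpos hx]
      linarith [hs p.2 _ _ hx, hR'.1]
  exact ⟨(Equiv.ofBijective f hbij).toHomeomorphOfContinuousClosed hf hproper.isClosedMap,
    fun p => rfl⟩

/-- A homeomorphism of the plane that turns no vector `z - w` by a half turn. -/
def NoHalfTurn (e : ℂ ≃ₜ ℂ) : Prop :=
  ∀ z w, z ≠ w → (e z - e w) / (z - w) ∈ Complex.slitPlane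

theorem NoHalfTurn.symm {e : ℂ ≃ₜ ℂ} (h : NoHalfTurn e) : NoHalfTurn e.symm := by
  intro z w hzw
  have := h (e.symm z) (e.symm w) fun hc => hzw (e.symm.injective hc)
  rw [e.apply_symm_apply, e.apply_symm_apply] at this
  rw [← inv_div]
  have h0 := Complex.normSq_pos.2 (Complex.slitPlane_ne_zero this)
  rw [Complex.mem_slitPlane_iff] at this ⊢
  rw [Complex.inv_re, Complex.inv_im]
  exact this.imp (div_pos · h0) fun hi => div_ne_zero (neg_ne_zero.2 hi) h0.ne'

/-- The argument of `e z - e p` differs from that of `z - p` by the principal argument of their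
quotient, which is a continuous function of `z`: both have the same total variation along a closed
curve. -/
theorem NoHalfTurn.hasWinding {e : ℂ ≃ₜ ℂ} (h : NoHalfTurn e) {γ : Circle → ℂ} {p : ℂ} {k : ℤ}
    (hγ : HasWinding γ p k) : HasWinding (fun t => e (γ t)) (e p) k := by
  obtain ⟨L, hL, hexp, hper⟩ := hγ
  have hne : ∀ t, γ (Circle.exp t) - p ≠ 0 := fun t => hexp t ▸ Complex.exp_ne_zero _
  have hcont : Continuous fun t => γ (Circle.exp t) := by
    have : (fun t => γ (Circle.exp t)) = fun t => Complex.exp (L t) + p := by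
      funext t
      rw [hexp, sub_add_cancel]
    rw [this]
    fun_prop
  let q : ℝ → ℂ := fun t => (e (γ (Circle.exp t)) - e p) / (γ (Circle.exp t) - p)
  have hq : ∀ t, q t ∈ Complex.slitPlane := fun t => h _ _ (sub_ne_zero.1 (hne t))
  have hqc : Continuous q :=
    ((e.continuous.comp hcont).sub continuous_const).div (hcont.sub continuous_const) hne
  refine ⟨fun t => L t + Complex.log (q t), hL.add (hqc.clog hq), fun t => ?_, ?_⟩
  · rw [Complex.exp_add, Complex.exp_log (Complex.slitPlane_ne_zero (hq t)), hexp,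
      mul_div_cancel₀ _ (hne t)]
  · have : q (2 * Real.pi) = q 0 := by simp [q]
    simp only [this, hper]
    ring

theorem NoHalfTurn.hasWinding_iff {e : ℂ ≃ₜ ℂ} (h : NoHalfTurn e) {γ : Circle → ℂ} {p : ℂ} {k : ℤ} :
    HasWinding γ p k ↔ HasWinding (fun t => e (γ t)) (e p) k :=
  ⟨h.hasWinding, fun H => by simpa using h.symm.hasWinding H⟩

theorem div_mem_slitPlane {u v : ℂ} (hv : v ≠ 0)
    (h : ∀ r ≤ (0 : ℝ), u.re = r * v.re → u.im = r * v.im → False) :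
    u / v ∈ Complex.slitPlane := by
  rw [Complex.mem_slitPlane_iff]
  by_contra! hc
  have e := div_mul_cancel₀ u hv
  refine h _ hc.1 ?_ ?_
  · simpa [Complex.mul_re, hc.2] using (congrArg Complex.re e).symm
  · simpa [Complex.mul_im, hc.2] using (congrArg Complex.im e).symm

theorem exists_horizontal_shear {h : ℝ → ℝ → ℝ} (hc : Continuous fun p : ℝ × ℝ => h p.1 p.2)
    {δ : ℝ} (hδ : 0 < δ) (hs : ∀ y x x', x ≤ x' → δ * (x' - x) ≤ h x' y - h x y)
    {C : ℝ} (hC : ∀ y, |h 0 y| ≤ C) :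
    ∃ e : ℂ ≃ₜ ℂ, NoHalfTurn e ∧ ∀ z, e z = ⟨h z.re z.im, z.im⟩ := by
  obtain ⟨e, he⟩ := exists_homeomorph_shear hc hδ hs hC
  let c : ℂ ≃ₜ ℝ × ℝ := Complex.equivRealProdCLM.toHomeomorph
  have key : ∀ z, (c.trans (e.trans c.symm)) z = (⟨h z.re z.im, z.im⟩ : ℂ) := by
    intro z
    change c.symm (e (z.re, z.im)) = _
    rw [he]
    rfl
  refine ⟨c.trans (e.trans c.symm), fun z w hzw => ?_, key⟩
  rw [key, key]
  refine div_mem_slitPlane (sub_ne_zero.2 hzw) fun r hr h1 h2 => ?_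
  simp only [Complex.sub_re, Complex.sub_im] at h1 h2
  have hd : z.im = w.im := by nlinarith
  have ha : z.re ≠ w.re := fun ha => hzw (Complex.ext ha hd)
  rw [hd] at h1
  rcases ha.lt_or_gt with ha | ha
  · nlinarith [hs w.im _ _ ha.le]
  · nlinarith [hs w.im _ _ ha.le]

theorem exists_vertical_shear {h : ℝ → ℝ → ℝ} (hc : Continuous fun p : ℝ × ℝ => h p.1 p.2)
    {δ : ℝ} (hδ : 0 < δ) (hs : ∀ y x x', x ≤ x' → δ * (x' - x) ≤ h x' y - h x y)
    {C : ℝ} (hC : ∀ y, |h 0 y| ≤ C) :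
    ∃ e : ℂ ≃ₜ ℂ, NoHalfTurn e ∧ ∀ z, e z = ⟨z.re, h z.im z.re⟩ := by
  obtain ⟨e, he⟩ := exists_homeomorph_shear hc hδ hs hC
  let c : ℂ ≃ₜ ℝ × ℝ := Complex.equivRealProdCLM.toHomeomorph.trans (Homeomorph.prodComm ℝ ℝ)
  have key : ∀ z, (c.trans (e.trans c.symm)) z = (⟨z.re, h z.im z.re⟩ : ℂ) := by
    intro z
    change c.symm (e (z.im, z.re)) = _
    rw [he]
    rfl
  refine ⟨c.trans (e.trans c.symm), fun z w hzw => ?_, key⟩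
  rw [key, key]
  refine div_mem_slitPlane (sub_ne_zero.2 hzw) fun r hr h1 h2 => ?_
  simp only [Complex.sub_re, Complex.sub_im] at h1 h2
  have hd : z.re = w.re := by nlinarith
  have ha : z.im ≠ w.im := fun ha => hzw (Complex.ext hd ha)
  rw [hd] at h2
  rcases ha.lt_or_gt with ha | ha
  · nlinarith [hs w.re _ _ ha.le]
  · nlinarith [hs w.re _ _ ha.le]

/-! ### The shears that merge two polygons -/

/-- The piecewise linear map of the line that fixes `0` and `1` and carries the `n + r` arcs of the
central polygon of `A_{n,n+r}` to the intervals that lie below the arcs of the merged polygon of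
`A_{n,r+1}`: the first `n` of them to those below the children of `node 0 []`, and the others to the
arcs of the central polygon that follow the first one. In the coordinates
`U = (2 * (n + r) + 1) * x` and `V = (2 * r + 3) * spread n r x` it is `V = 1 + U / (2 * n + 1)` for
`1 ≤ U ≤ 2 * n` and `V = U + 2 - 2 * n` for `2 * n + 1 ≤ U`. -/
noncomputable def spread (n r : ℕ) (x : ℝ) : ℝ :=
  ((2 * (n + r) + 1) * x / (2 * n + 1) + min ((2 * (n + r) + 1) * x) 1 +
    max 0 (min 1 ((2 * (n + r) + 1) * x - 2 * n)) +
    2 * n / (2 * n + 1) * max 0 ((2 * (n + r) + 1) * x - (2 * n + 1))) / (2 * r + 3)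

/-- The piecewise linear map of the line that fixes `0` and `1` and carries `1 / 2` to the abscissa
`(3 / 2) / (2 * r + 3)` of the vertex `node 0 []` of `A_{n,r+1}`. -/
noncomputable def recentre (r : ℕ) (x : ℝ) : ℝ :=
  x - 2 * r / (2 * r + 3) * max 0 (min x (1 - x))

/-- The interpolation between `recentre`, at and below the height `-1 / 2` of the central puncture,
and `spread`, at the nonnegative heights. -/
noncomputable def slide (n r : ℕ) (x y : ℝ) : ℝ :=
  max 0 (min 1 (2 * y + 1)) * spread n r x + (1 - max 0 (min 1 (2 * y + 1))) * recentre r x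

/-- The height of the polygon of the vertex `node 0 []` of `A_{n,r+1}` over the point `x`. -/
noncomputable def roof (n r : ℕ) (x : ℝ) : ℝ :=
  max 0 (min 1 (min ((2 * n + 2) * ((2 * r + 3) * x - 1)) ((2 * n + 2) * (2 - (2 * r + 3) * x))))

/-- The stretching of the vertical line over `x` that fixes the height `-1` and raises the heights
`y ≥ -1 / 2` by `roof n r x`. -/
noncomputable def lift (n r : ℕ) (y x : ℝ) : ℝ :=
  y + roof n r x * min 1 (2 * (y + 1))

variable {n r : ℕ}

theorem roof_nonneg (x : ℝ) : 0 ≤ roof n r x := le_max_left _ _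

theorem roof_le_one (x : ℝ) : roof n r x ≤ 1 := max_le zero_le_one (min_le_left _ _)

theorem spread_slope {x x' : ℝ} (h : x ≤ x') :
    1 / (2 * r + 3) * (x' - x) ≤ spread n r x' - spread n r x := by
  have hU : (2 * (n + r) + 1) * x ≤ (2 * (n + r) + 1) * x' := by gcongr
  have h1 : x' - x ≤ (2 * (n + r) + 1) * x' / (2 * n + 1) - (2 * (n + r) + 1) * x / (2 * n + 1) := by
    rw [← sub_div, ← mul_sub, le_div_iff₀ (by positivity), mul_comm]
    have : (0 : ℝ) ≤ r := by positivity
    gcongr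
    linarith
  have h2 := min_le_min_right 1 hU
  have h3 := max_le_max_left 0 (min_le_min_left 1 (sub_le_sub_right hU (2 * (n : ℝ))))
  have h4 := mul_le_mul_of_nonneg_left
    (max_le_max_left 0 (sub_le_sub_right hU (2 * (n : ℝ) + 1)))
    (by positivity : (0 : ℝ) ≤ 2 * n / (2 * n + 1))
  unfold spread
  rw [← sub_div, one_div_mul_eq_div]
  exact div_le_div_of_nonneg_right (by linarith) (by positivity)

theorem recentre_slope {x x' : ℝ} (h : x ≤ x') :
    1 / (2 * r + 3) * (x' - x) ≤ recentre r x' - recentre r x := by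
  have hm : max 0 (min x' (1 - x')) - max 0 (min x (1 - x)) ≤ x' - x := by
    have : max 0 (min x' (1 - x')) ≤ max 0 (min x (1 - x)) + (x' - x) := by
      refine max_le (by linarith [le_max_left 0 (min x (1 - x))]) ?_
      rcases le_total x (1 - x) with hx | hx
      · linarith [min_le_left x' (1 - x'), le_max_right 0 (min x (1 - x)), min_eq_left hx]
      · linarith [min_le_right x' (1 - x'), le_max_right 0 (min x (1 - x)), min_eq_right hx]
    linarith
  have hr : (0 : ℝ) < 2 * r + 3 := by positivity
  have e : 2 * (r : ℝ) / (2 * r + 3) = 1 - 3 * (1 / (2 * r + 3)) := by field_simp; ring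
  have h0 : (0 : ℝ) ≤ 2 * r / (2 * r + 3) := by positivity
  have := mul_le_mul_of_nonneg_left hm h0
  have h1 : 0 ≤ 1 / (2 * (r : ℝ) + 3) * (x' - x) := mul_nonneg (by positivity) (by linarith)
  unfold recentre
  nlinarith

theorem slide_slope (y : ℝ) {x x' : ℝ} (h : x ≤ x') :
    1 / (2 * r + 3) * (x' - x) ≤ slide n r x' y - slide n r x y := by
  have h0 : 0 ≤ max 0 (min 1 (2 * y + 1)) := le_max_left _ _
  have h1 : max 0 (min 1 (2 * y + 1)) ≤ 1 := max_le zero_le_one (min_le_left _ _)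
  unfold slide
  nlinarith [mul_le_mul_of_nonneg_left (spread_slope (n := n) (r := r) h) h0,
    mul_le_mul_of_nonneg_left (recentre_slope (r := r) h) (sub_nonneg.2 h1)]

theorem slide_zero (y : ℝ) : slide n r 0 y = 0 := by
  have h1 : spread n r 0 = 0 := by
    have h : max 0 (-1 + -(2 * (n : ℝ))) = 0 := max_eq_left (by linarith [n.cast_nonneg (α := ℝ)])
    have h' : min 1 (-(2 * (n : ℝ))) = -(2 * n) :=
      min_eq_right (by linarith [n.cast_nonneg (α := ℝ)])
    simp [spread, h, h']
  simp [slide, h1, recentre]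

theorem spread_of_le {x : ℝ} (h1 : 1 ≤ (2 * (n + r) + 1) * x)
    (h2 : (2 * (n + r) + 1) * x ≤ 2 * n) :
    spread n r x = (1 + (2 * (n + r) + 1) * x / (2 * n + 1)) / (2 * r + 3) := by
  rw [spread, min_eq_right h1, min_eq_right (by linarith), max_eq_left (by linarith),
    max_eq_left (by linarith)]
  ring

theorem spread_of_ge {x : ℝ} (h : 2 * n + 1 ≤ (2 * (n + r) + 1) * x) :
    spread n r x = ((2 * (n + r) + 1) * x + 2 - 2 * n) / (2 * r + 3) := by
  have hn : (0 : ℝ) ≤ n := by positivity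
  rw [spread, min_eq_right (by linarith), min_eq_left (by linarith), max_eq_right (by linarith),
    max_eq_right (by linarith)]
  field_simp
  ring

theorem slide_one (y : ℝ) : slide n r 1 y = 1 := by
  have h1 : spread n r 1 = 1 := by
    rw [spread_of_ge (by linarith [r.cast_nonneg (α := ℝ)]), div_eq_one_iff_eq (by positivity)]
    ring
  simp [slide, h1, recentre]

theorem slide_of_nonneg (x : ℝ) {y : ℝ} (hy : 0 ≤ y) : slide n r x y = spread n r x := by
  rw [slide, min_eq_left (by linarith), max_eq_right zero_le_one]
  ring

theorem continuous_slide : Continuous fun p : ℝ × ℝ => slide n r p.1 p.2 := by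
  unfold slide spread recentre
  fun_prop

theorem lift_slope (x : ℝ) {y y' : ℝ} (h : y ≤ y') :
    1 * (y' - y) ≤ lift n r y' x - lift n r y x := by
  have := mul_le_mul_of_nonneg_left
    (min_le_min_left 1 (by linarith : 2 * (y + 1) ≤ 2 * (y' + 1))) (roof_nonneg (n := n) (r := r) x)
  unfold lift
  linarith

theorem lift_of_ge {x y : ℝ} (hy : -1 / 2 ≤ y) : lift n r y x = y + roof n r x := by
  rw [lift, min_eq_left (by linarith), mul_one]

theorem lift_neg_one (x : ℝ) : lift n r (-1) x = -1 := by
  simp [lift]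

theorem continuous_lift : Continuous fun p : ℝ × ℝ => lift n r p.1 p.2 := by
  unfold lift roof
  fun_prop

/-- The composition of the horizontal shear `slide` and the vertical shear `lift`. -/
theorem exists_homeomorph_merge (n r : ℕ) :
    ∃ e : ℂ ≃ₜ ℂ,
      (∀ (γ : Circle → ℂ) (p : ℂ) (k : ℤ),
        HasWinding γ p k ↔ HasWinding (fun t => e (γ t)) (e p) k) ∧
      ∀ z, e z = ⟨slide n r z.re z.im, lift n r z.im (slide n r z.re z.im)⟩ := by
  obtain ⟨e, he, he'⟩ := exists_horizontal_shear (continuous_slide (n := n) (r := r))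
    (δ := 1 / (2 * r + 3)) (by positivity) (fun y _ _ h => slide_slope y h) (C := 0)
    (fun y => by simp [slide_zero])
  obtain ⟨f, hf, hf'⟩ := exists_vertical_shear (continuous_lift (n := n) (r := r))
    one_pos (fun y _ _ h => lift_slope y h) (C := 1) (fun x => by
      rw [lift_of_ge (by norm_num), zero_add, abs_of_nonneg (roof_nonneg x)]
      exact roof_le_one x)
  exact ⟨e.trans f, fun γ p k => he.hasWinding_iff.trans hf.hasWinding_iff, fun z => by
    simp [hf', he']⟩

/-! ### The images of the polygons -/

section

variable {n r : ℕ}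

/-- The polygons of noncentral vertices are similar up to an affine change of the abscissa. -/
theorem image_closedPolygon_node {m k d : ℕ} {i : Fin m} {i' : Fin k} {l l' : List (Fin n)}
    {f : ℂ → ℂ} {α β : ℝ} (hα : 0 < α) (hleft : left n k i' l' = α * left n m i l + β)
    (hwidth : width n k l' = α * width n m l) (hlen : l'.length = l.length + d)
    (hf : ∀ z ∈ closedPolygon n m (.node i l), f z = ⟨α * z.re + β, z.im + d⟩) :
    f '' closedPolygon n m (.node i l) = closedPolygon n k (.node i' l') ∧
      f (vertexPoint n m (.node i l)) = vertexPoint n k (.node i' l') := by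
  have key : ∀ x y : ℝ, (⟨α * x + β, y + d⟩ : ℂ) ∈ closedPolygon n k (.node i' l') ↔
      (⟨x, y⟩ : ℂ) ∈ closedPolygon n m (.node i l) := by
    intro x y
    have hl : (l'.length : ℝ) = l.length + d := by exact_mod_cast hlen
    simp only [closedPolygon, mem_ofPred_eq, hleft, hwidth, hl]
    refine and_congr ⟨fun h => by linarith, fun h => by linarith⟩
      (and_congr ⟨fun h => by linarith, fun h => by linarith⟩ (and_congr ?_ ?_))
    · conv_rhs => rw [← mul_le_mul_iff_right₀ hα]
      ring_nf
    · conv_rhs => rw [← mul_le_mul_iff_right₀ hα]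
      ring_nf
  constructor
  · apply Subset.antisymm
    · rintro _ ⟨z, hz, rfl⟩
      rw [hf z hz]
      exact (key _ _).2 hz
    · intro w hw
      have hw' : w = ⟨α * ((w.re - β) / α) + β, w.im - d + d⟩ := by
        apply Complex.ext
        · field_simp
          ring
        · ring
      rw [hw', key] at hw
      exact ⟨_, hw, by rw [hf _ hw, hw']; apply Complex.ext <;> field_simp <;> ring⟩
  · have hv := axisPoint_mem (n := n) (m := m) (t := 1 / 2) (by norm_num) (by norm_num) (.node i l)
    rw [axisPoint_half] at hv
    rw [hf _ hv]
    have hl : (l'.length : ℝ) = l.length + d := by exact_mod_cast hlen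
    apply Complex.ext
    · simp only [vertexPoint, hleft, hwidth]
      ring
    · simp only [vertexPoint, hl]
      ring

/-- The bijection from the vertices of `A_{n,n+r}` to the noncentral vertices of `A_{n,r+1}` induced
by merging the central polygon of the latter with the polygon of `node 0 []`. The first `n`
neighbours of the centre go to the children of `node 0 []`. -/
def mergeVertex {n r : ℕ} : Vertex n (n + r) → Vertex n (r + 1)
  | .root => .node 0 []
  | .node i l => Fin.addCases (fun j => .node 0 (l ++ [j])) (fun i' => .node i'.succ l) i

theorem mergeVertex_castAdd (j : Fin n) (l : List (Fin n)) :
    mergeVertex (.node (Fin.castAdd r j) l) = .node 0 (l ++ [j]) := by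
  simp [mergeVertex]

theorem mergeVertex_natAdd (i : Fin r) (l : List (Fin n)) :
    mergeVertex (.node (Fin.natAdd n i) l) = .node i.succ l := by
  simp [mergeVertex]

theorem mergeVertex_ne_root (v : Vertex n (n + r)) : mergeVertex v ≠ .root := by
  rcases v with _ | ⟨i, l⟩
  · simp [mergeVertex]
  · refine Fin.addCases (fun j => ?_) (fun i => ?_) i
    · simp [mergeVertex_castAdd]
    · simp [mergeVertex_natAdd]

theorem mergeVertex_node_ne (i : Fin (n + r)) (l : List (Fin n)) :
    mergeVertex (.node i l) ≠ .node 0 [] := by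
  refine Fin.addCases (fun j => ?_) (fun i => ?_) i
  · simp [mergeVertex_castAdd]
  · simp [mergeVertex_natAdd]

theorem exists_mergeVertex_eq {w : Vertex n (r + 1)} (hw : w ≠ .root) :
    ∃ v : Vertex n (n + r), mergeVertex v = w := by
  rcases w with _ | ⟨i, l⟩
  · exact absurd rfl hw
  · refine Fin.cases ?_ (fun i => ⟨_, mergeVertex_natAdd i l⟩) i
    rcases List.eq_nil_or_concat l with rfl | ⟨l, j, rfl⟩
    · exact ⟨.root, rfl⟩
    · exact ⟨_, by rw [mergeVertex_castAdd, List.concat_eq_append]⟩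

theorem range_mergeVertex : range (mergeVertex (n := n) (r := r)) = {Vertex.root}ᶜ := by
  ext w
  exact ⟨by rintro ⟨v, rfl⟩; exact mergeVertex_ne_root v, exists_mergeVertex_eq⟩

theorem width_append (j : Fin n) (l : List (Fin n)) :
    width n (r + 1) (l ++ [j]) =
      (2 * (n + r) + 1) / ((2 * n + 1) * (2 * r + 3)) * width n (n + r) l := by
  simp only [width, List.length_append, List.length_singleton, pow_succ]
  push_cast
  field_simp
  ring

theorem width_succ (l : List (Fin n)) :
    width n (r + 1) l = (2 * (n + r) + 1) / (2 * r + 3) * width n (n + r) l := by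
  simp only [width]
  push_cast
  field_simp
  ring

theorem left_append (j : Fin n) : ∀ l : List (Fin n),
    left n (r + 1) 0 (l ++ [j]) =
      (2 * (n + r) + 1) / ((2 * n + 1) * (2 * r + 3)) * left n (n + r) (Fin.castAdd r j) l +
        1 / (2 * r + 3)
  | [] => by
    simp only [left, width, List.nil_append, List.length_singleton, Fin.val_castAdd,
      Fin.val_zero]
    push_cast
    field_simp
    ring
  | j' :: l => by
    rw [List.cons_append, left, left_append j l, left, ← List.cons_append, width_append]
    ring

theorem left_succ (i : Fin r) : ∀ l : List (Fin n),
    left n (r + 1) i.succ l =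
      (2 * (n + r) + 1) / (2 * r + 3) * left n (n + r) (Fin.natAdd n i) l +
        (2 - 2 * n) / (2 * r + 3)
  | [] => by
    simp only [left, Fin.val_natAdd, Fin.val_succ]
    push_cast
    field_simp
    ring
  | j' :: l => by
    rw [left, left_succ i l, left, width_succ]
    ring

/-- The polygons of `node i l` lie over the `i`-th arc of the central polygon. -/
theorem node_interval_base {m : ℕ} {i : Fin m} : ∀ {l : List (Fin n)} {z : ℂ},
    z ∈ closedPolygon n m (.node i l) →
    2 * (i : ℕ) + 1 ≤ (2 * m + 1) * z.re ∧ (2 * m + 1) * z.re ≤ 2 * (i : ℕ) + 2 := by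
  have base : ∀ (l : List (Fin n)) (x : ℝ), left n m i l ≤ x → x ≤ left n m i l + width n m l →
      2 * (i : ℕ) + 1 ≤ (2 * m + 1) * x ∧ (2 * m + 1) * x ≤ 2 * (i : ℕ) + 2 := by
    intro l
    induction l with
    | nil =>
      intro x h1 h2
      have hm : (0 : ℝ) < 2 * m + 1 := by positivity
      simp only [left, width, List.length_nil, pow_zero, mul_one, ← add_div] at h1 h2
      rw [div_le_iff₀ hm] at h1
      rw [le_div_iff₀ hm] at h2
      constructor <;> linarith
    | cons j l ih =>
      intro x h1 h2
      obtain ⟨h1, h2⟩ := child_interval h1 h2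
      exact ih x h1 h2
  intro l z hz
  exact base l z.re (node_interval hz).1 (node_interval hz).2

theorem roof_eq_one {x : ℝ} (h1 : 1 + 1 / (2 * n + 1) ≤ (2 * r + 3) * x)
    (h2 : (2 * r + 3) * x ≤ 2 - 1 / (2 * n + 1)) : roof n r x = 1 := by
  have hn : (0 : ℝ) < 2 * n + 1 := by positivity
  have e : 1 ≤ (2 * (n : ℝ) + 2) * (1 / (2 * n + 1)) := by
    rw [mul_one_div, le_div_iff₀ hn]
    linarith
  rw [roof, min_eq_left (le_min ?_ ?_), max_eq_right zero_le_one]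
  · exact e.trans (by gcongr; linarith)
  · exact e.trans (by gcongr; linarith)

theorem roof_eq_zero {x : ℝ} (h : 2 ≤ (2 * r + 3) * x) : roof n r x = 0 := by
  refine max_eq_left ((min_le_right _ _).trans ((min_le_right _ _).trans ?_))
  exact mul_nonpos_of_nonneg_of_nonpos (by positivity) (by linarith)

/-- The central polygon and the polygon of `node 0 []` fill the region below the graph of `roof`. -/
theorem merged_polygon (x y : ℝ) :
    (⟨x, y⟩ : ℂ) ∈ closedPolygon n (r + 1) .root ∪ closedPolygon n (r + 1) (.node 0 []) ↔
      (0 ≤ x ∧ x ≤ 1) ∧ -1 ≤ y ∧ y ≤ roof n r x := by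
  have hr : (0 : ℝ) < 2 * r + 3 := by positivity
  have hn : (0 : ℝ) < 2 * n + 2 := by positivity
  have h1 : y * (1 / (2 * r + 3)) ≤ (2 * n + 2) * (x - 1 / (2 * r + 3)) ↔
      y ≤ (2 * n + 2) * ((2 * r + 3) * x - 1) := by
    rw [← mul_le_mul_iff_left₀ hr]
    field_simp
  have h2 : y * (1 / (2 * r + 3)) ≤ (2 * n + 2) * (1 / (2 * r + 3) + 1 / (2 * r + 3) - x) ↔
      y ≤ (2 * n + 2) * (2 - (2 * r + 3) * x) := by
    rw [← mul_le_mul_iff_left₀ hr]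
    field_simp
    ring_nf
  have e : (2 * ((r + 1 : ℕ) : ℝ) + 1) = 2 * r + 3 := by push_cast; ring
  simp only [closedPolygon, mem_union, mem_ofPred_eq, left, width, e, List.length_nil,
    Nat.cast_zero, sub_zero, pow_zero, mul_one, Fin.val_zero, mul_zero, zero_add, h1, h2, roof,
    le_max_iff, le_min_iff]
  constructor
  · rintro (⟨a, b, c, d⟩ | ⟨a, b, c, d⟩)
    · exact ⟨⟨a, b⟩, c, Or.inl d⟩
    · have p1 : 0 ≤ (2 * r + 3) * x - 1 := nonneg_of_mul_nonneg_right (a.trans c) hn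
      have p2 : 0 ≤ 2 - (2 * r + 3) * x := nonneg_of_mul_nonneg_right (a.trans d) hn
      refine ⟨⟨?_, ?_⟩, by linarith, Or.inr ⟨b, c, d⟩⟩
      · exact nonneg_of_mul_nonneg_right (by linarith) hr
      · by_contra! hx
        nlinarith
  · rintro ⟨⟨a, b⟩, c, d | d⟩
    · exact Or.inl ⟨a, b, c, d⟩
    · rcases le_total y 0 with hy | hy
      · exact Or.inl ⟨a, b, c, hy⟩
      · exact Or.inr ⟨hy, d⟩

/-- The homeomorphism of the plane that carries the central polygon of `A_{n,n+r}` to the union of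
two polygons of `A_{n,r+1}`, and the other polygons to polygons. -/
theorem exists_homeomorph_plane (n r : ℕ) :
    ∃ e : ℂ ≃ₜ ℂ,
      (∀ (γ : Circle → ℂ) (p : ℂ) (k : ℤ),
        HasWinding γ p k ↔ HasWinding (fun t => e (γ t)) (e p) k) ∧
      e '' closedPolygon n (n + r) .root =
        closedPolygon n (r + 1) .root ∪ closedPolygon n (r + 1) (.node 0 []) ∧
      (∀ i l, e '' closedPolygon n (n + r) (.node i l) =
        closedPolygon n (r + 1) (mergeVertex (.node i l))) ∧
      ∀ v, e (vertexPoint n (n + r) v) = vertexPoint n (r + 1) (mergeVertex v) := by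
  obtain ⟨e, hw, he⟩ := exists_homeomorph_merge n r
  have hr : (0 : ℝ) < 2 * r + 3 := by positivity
  have hn : (0 : ℝ) < 2 * n + 1 := by positivity
  have hnode : ∀ i l, e '' closedPolygon n (n + r) (.node i l) =
      closedPolygon n (r + 1) (mergeVertex (.node i l)) ∧
      e (vertexPoint n (n + r) (.node i l)) = vertexPoint n (r + 1) (mergeVertex (.node i l)) := by
    intro i l
    refine Fin.addCases (fun j => ?_) (fun i => ?_) i
    · rw [mergeVertex_castAdd]
      refine image_closedPolygon_node (d := 1) (by positivity) (left_append j l)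
        (width_append j l) (by simp) fun z hz => ?_
      have hj : ((j : ℕ) : ℝ) + 1 ≤ n := by exact_mod_cast j.2
      have hj0 : (0 : ℝ) ≤ (j : ℕ) := by positivity
      have hy : (l.length : ℝ) ≤ z.im := hz.1
      have hy0 : (0 : ℝ) ≤ l.length := by positivity
      obtain ⟨h1, h2⟩ := node_interval_base hz
      rw [Fin.val_castAdd] at h1 h2
      push_cast at h1 h2
      have hs := spread_of_le (n := n) (r := r) (x := z.re) (by linarith) (by linarith)
      have hs' : (2 * r + 3) * spread n r z.re = 1 + (2 * (n + r) + 1) * z.re / (2 * n + 1) := by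
        rw [hs, mul_div_cancel₀ _ hr.ne']
      have hroof : roof n r (spread n r z.re) = 1 := by
        apply roof_eq_one
        · rw [hs']
          gcongr
          linarith
        · rw [hs', le_sub_iff_add_le, add_assoc, ← add_div]
          have : ((2 * (n + r) + 1) * z.re + 1) / (2 * n + 1) ≤ 1 := by
            rw [div_le_one hn]
            linarith
          linarith
      rw [he, slide_of_nonneg _ (by linarith), lift_of_ge (by linarith), hroof, hs]
      apply Complex.ext
      · simp only
        field_simp
        ring
      · simp
    · rw [mergeVertex_natAdd]
      refine image_closedPolygon_node (d := 0) (by positivity) (left_succ i l)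
        (width_succ l) (by simp) fun z hz => ?_
      have hj0 : (0 : ℝ) ≤ (i : ℕ) := by positivity
      have hy : (l.length : ℝ) ≤ z.im := hz.1
      have hy0 : (0 : ℝ) ≤ l.length := by positivity
      obtain ⟨h1, -⟩ := node_interval_base hz
      rw [Fin.val_natAdd] at h1
      push_cast at h1
      have hs := spread_of_ge (n := n) (r := r) (x := z.re) (by linarith)
      have hroof : roof n r (spread n r z.re) = 0 := by
        apply roof_eq_zero
        rw [hs, mul_div_cancel₀ _ hr.ne']
        linarith
      rw [he, slide_of_nonneg _ (by linarith), lift_of_ge (by linarith), hroof, hs]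
      apply Complex.ext
      · simp only
        field_simp
        ring
      · simp
  refine ⟨e, hw, ?_, fun i l => (hnode i l).1, ?_⟩
  · have mono : ∀ y, StrictMono fun x => slide n r x y := fun y x x' h => by
      have : 0 < 1 / (2 * (r : ℝ) + 3) * (x' - x) := mul_pos (by positivity) (by linarith)
      have := slide_slope (n := n) (r := r) y h.le
      simp only
      linarith
    have mono' : ∀ x, StrictMono fun y => lift n r y x := fun x y y' h => by
      have := lift_slope (n := n) (r := r) x h.le
      simp only
      linarith
    have h : ∀ z, e z ∈ closedPolygon n (r + 1) .root ∪ closedPolygon n (r + 1) (.node 0 []) ↔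
        z ∈ closedPolygon n (n + r) .root := by
      intro z
      rw [he, merged_polygon]
      have h0 : 0 ≤ slide n r z.re z.im ↔ 0 ≤ z.re := by
        simpa [slide_zero] using (mono z.im).le_iff_le (a := 0) (b := z.re)
      have h1 : slide n r z.re z.im ≤ 1 ↔ z.re ≤ 1 := by
        simpa [slide_one] using (mono z.im).le_iff_le (a := z.re) (b := 1)
      have h2 : ∀ x, -1 ≤ lift n r z.im x ↔ -1 ≤ z.im := fun x => by
        simpa [lift_neg_one] using (mono' x).le_iff_le (a := -1) (b := z.im)
      have h3 : ∀ x, lift n r z.im x ≤ roof n r x ↔ z.im ≤ 0 := fun x => by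
        simpa [lift_of_ge (n := n) (r := r) (x := x) (y := 0) (by norm_num)] using
          (mono' x).le_iff_le (a := z.im) (b := 0)
      rw [h0, h1, h2, h3, and_assoc]
      rfl
    rw [← e.preimage_symm]
    ext z
    rw [mem_preimage, ← h, e.apply_symm_apply]
  · rintro (_ | ⟨i, l⟩)
    · have hs : slide n r (1 / 2) (-1 / 2) = 3 / 2 / (2 * r + 3) := by
        norm_num [slide, recentre]
        field_simp
        ring
      have hroof : roof n r (3 / 2 / (2 * r + 3)) = 1 := by
        rw [roof, mul_div_cancel₀ _ hr.ne', min_eq_left, max_eq_right zero_le_one]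
        refine le_min ?_ ?_ <;> linarith [n.cast_nonneg (α := ℝ)]
      rw [he]
      simp only [vertexPoint, mergeVertex, hs]
      rw [lift_of_ge le_rfl, hroof]
      apply Complex.ext
      · simp only [left, width, Fin.val_zero, List.length_nil]
        push_cast
        field_simp
        ring
      · simp only [List.length_nil]
        norm_num
    · exact (hnode i l).2

end

/-! ### The homeomorphism between the arboreal surfaces -/

section

variable {n r : ℕ}

theorem injective_polygon (n m : ℕ) (X : Set (Vertex n m)) :
    Function.Injective (polygon n m X) := by
  intro v w h
  obtain ⟨x, hx, hx'⟩ := (isPolygonDecomposition n m X).core v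
  exact (hx' w (h ▸ hx)).symm

theorem exists_homeomorph_surface (n r : ℕ) :
    ∃ ψ : surface n (n + r) (sharp n (n + r)) ≃ₜ surface n (r + 1) (star n (r + 1)),
      PreservesWinding ψ ∧
      ψ '' polygon n (n + r) (sharp n (n + r)) .root =
        polygon n (r + 1) (star n (r + 1)) .root ∪
          polygon n (r + 1) (star n (r + 1)) (.node 0 []) ∧
      ∀ v ≠ .root, ψ '' polygon n (n + r) (sharp n (n + r)) v =
        polygon n (r + 1) (star n (r + 1)) (mergeVertex v) := by
  obtain ⟨e, hw, hroot, hnode, hvertex⟩ := exists_homeomorph_plane n r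
  have hpunctures : e '' (vertexPoint n (n + r) '' sharp n (n + r)) =
      vertexPoint n (r + 1) '' star n (r + 1) := by
    rw [star, ← range_mergeVertex, ← range_comp, sharp, image_univ, ← range_comp]
    exact congrArg range (funext hvertex)
  have hcover : e '' (⋃ v, closedPolygon n (n + r) v) = ⋃ w, closedPolygon n (r + 1) w := by
    rw [image_iUnion]
    apply Subset.antisymm
    · refine iUnion_subset fun v => ?_
      rcases v with _ | ⟨i, l⟩
      · rw [hroot]
        exact union_subset (subset_iUnion _ _) (subset_iUnion _ _)
      · rw [hnode]
        exact subset_iUnion _ _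
    · refine iUnion_subset fun w => ?_
      by_cases hwr : w = .root
      · refine subset_iUnion_of_subset .root ?_
        rw [hroot, hwr]
        exact subset_union_left
      · obtain ⟨v, rfl⟩ := exists_mergeVertex_eq hwr
        refine subset_iUnion_of_subset v ?_
        rcases v with _ | ⟨i, l⟩
        · rw [hroot]
          exact subset_union_right
        · exact (hnode i l).superset
  have hsurface : surface n (n + r) (sharp n (n + r)) = e ⁻¹' surface n (r + 1) (star n (r + 1)) := by
    rw [surface, surface, ← hpunctures, ← hcover, ← image_sdiff e.injective,
      preimage_image_eq _ e.injective]
  have himage : ∀ (A B : Set ℂ), e '' A = B →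
      (e.sets hsurface) '' (Subtype.val ⁻¹' A) = Subtype.val ⁻¹' B := by
    rintro A _ rfl
    ext y
    constructor
    · rintro ⟨x, hx, rfl⟩
      exact ⟨x, hx, rfl⟩
    · rintro ⟨x, hx, hxy⟩
      exact ⟨⟨x, hsurface ▸ (hxy ▸ y.2 : e x ∈ _)⟩, hx, Subtype.ext hxy⟩
  refine ⟨e.sets hsurface, fun γ p k => hw (fun t => γ t) p k, himage _ _ hroot, ?_⟩
  rintro (_ | ⟨i, l⟩) hv
  · exact absurd rfl hv
  · exact himage _ _ (hnode i l)

theorem tree_adj_root (n : ℕ) {m : ℕ} (i : Fin m) : (tree n m).Adj .root (.node i []) :=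
  (SimpleGraph.fromRel_adj _ _ _).2 ⟨by simp, Or.inl (.ofRoot i)⟩

theorem identifiesAfterMerging_of_image
    {ψ : surface n (n + r) (sharp n (n + r)) ≃ₜ surface n (r + 1) (star n (r + 1))}
    (hroot : ψ '' polygon n (n + r) (sharp n (n + r)) .root =
        polygon n (r + 1) (star n (r + 1)) .root ∪
          polygon n (r + 1) (star n (r + 1)) (.node 0 []))
    (hnode : ∀ v ≠ .root, ψ '' polygon n (n + r) (sharp n (n + r)) v =
        polygon n (r + 1) (star n (r + 1)) (mergeVertex v)) :
    IdentifiesAfterMerging ψ (.node 0 []) := by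
  refine ⟨hroot, Equiv.ofBijective (fun v => ⟨mergeVertex v.1, mergeVertex_ne_root v.1, ?_⟩)
    ⟨?_, ?_⟩, fun v => hnode v.1 v.2⟩
  · rcases v with ⟨_ | ⟨i, l⟩, hv⟩
    · exact absurd rfl hv
    · exact mergeVertex_node_ne i l
  · rintro ⟨v, hv⟩ ⟨w, hw⟩ h
    have h' : mergeVertex v = mergeVertex w := congrArg Subtype.val h
    refine Subtype.ext (injective_polygon n (n + r) (sharp n (n + r)) ?_)
    exact image_injective.2 ψ.injective (by rw [hnode v hv, hnode w hw, h'])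
  · rintro ⟨w, hw, hw'⟩
    obtain ⟨v, rfl⟩ := exists_mergeVertex_eq hw
    exact ⟨⟨v, fun hv => hw' (hv ▸ rfl)⟩, rfl⟩

theorem IdentifiesAfterMerging.matchesOff {n m k : ℕ} {b : Vertex n k}
    {ψ : surface n m (sharp n m) ≃ₜ surface n k (star n k)} (h : IdentifiesAfterMerging ψ b) :
    ∃ K', MatchesOff ψ (polygon n m (sharp n m)) (polygon n k (star n k)) {.root} K' := by
  classical
  obtain ⟨hroot, e, he⟩ := h
  refine ⟨{.root, b}, ?_, fun v hv => ?_, fun w hw => ?_⟩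
  · simp [hroot]
  · have hv' : v ≠ .root := by simpa using hv
    exact ⟨(e ⟨v, hv'⟩).1, by simpa using (e ⟨v, hv'⟩).2, he ⟨v, hv'⟩⟩
  · have hw' : w ≠ .root ∧ w ≠ b := by simpa using hw
    refine ⟨(e.symm ⟨w, hw'⟩).1, by simpa using (e.symm ⟨w, hw'⟩).2, ?_⟩
    rw [he, e.apply_symm_apply]

end

/-- Conjugation by a homeomorphism that preserves winding numbers and matches the rigid structures up
to merging finitely many polygons identifies the asymptotically rigid mapping class groups. -/
theorem exists_amod_mulEquiv {n m k : ℕ} {X : Set (Vertex n m)} {Y : Set (Vertex n k)}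
    {ψ : surface n m X ≃ₜ surface n k Y} (hψ : PreservesWinding ψ)
    {K : Finset (Vertex n m)} {K' : Finset (Vertex n k)}
    (h : MatchesOff ψ (polygon n m X) (polygon n k Y) K K') :
    ∃ Φ : amod n m X ≃* amod n k Y, ∀ φ : rigidHomeo n m X, ∃ χ : rigidHomeo n k Y,
      (χ : surface n k Y ≃ₜ surface n k Y) = (ψ.symm.trans φ.1).trans ψ ∧
        Φ (QuotientGroup.mk φ) = QuotientGroup.mk χ := by
  have hforth : ∀ f ∈ rigidHomeo n m X, conjHomeo ψ f ∈ rigidHomeo n k Y := fun f hf =>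
    ⟨hψ.orientationPreserving hf.1, h.asymptoticallyRigid (isPolygonDecomposition n m X) hf.2⟩
  have hback : ∀ g ∈ rigidHomeo n k Y, conjHomeo ψ.symm g ∈ rigidHomeo n m X := fun g hg =>
    ⟨hψ.symm.orientationPreserving hg.1,
      h.symm.asymptoticallyRigid (isPolygonDecomposition n k Y) hg.2⟩
  let c : rigidHomeo n m X ≃* rigidHomeo n k Y :=
    { toFun := fun f => ⟨conjHomeo ψ f.1, hforth f.1 f.2⟩
      invFun := fun g => ⟨conjHomeo ψ.symm g.1, hback g.1 g.2⟩
      left_inv := fun f => Subtype.ext ((conjHomeo ψ).symm_apply_apply f.1)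
      right_inv := fun g => Subtype.ext ((conjHomeo ψ).apply_symm_apply g.1)
      map_mul' := fun f g => Subtype.ext (map_mul (conjHomeo ψ) f.1 g.1) }
  have hc : ((isotopicToId (surface n m X)).subgroupOf (rigidHomeo n m X)).map
      (c : rigidHomeo n m X →* rigidHomeo n k Y) =
      (isotopicToId (surface n k Y)).subgroupOf (rigidHomeo n k Y) := by
    ext g
    constructor
    · rintro ⟨f, hf, rfl⟩
      exact conjHomeo_mem_isotopicToId ψ hf
    · intro hg
      exact ⟨c.symm g, conjHomeo_mem_isotopicToId ψ.symm hg, c.apply_symm_apply g⟩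
  exact ⟨QuotientGroup.congr _ _ c hc, fun φ => ⟨c φ, rfl, rfl⟩⟩

end ArborealSurface

theorem lemma2p1 (m n : ℕ) (hn : 1 ≤ n) (hnm : n ≤ m) :
    ∃ (ψ : ArborealSurface.surface n m (ArborealSurface.sharp n m) ≃ₜ
          ArborealSurface.surface n (m - n + 1) (ArborealSurface.star n (m - n + 1)))
      (b : ArborealSurface.Vertex n (m - n + 1)),
      (ArborealSurface.tree n (m - n + 1)).Adj .root b ∧
      ArborealSurface.IdentifiesAfterMerging ψ b ∧
      ∃ Φ : ArborealSurface.amod n m (ArborealSurface.sharp n m) ≃*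
          ArborealSurface.amod n (m - n + 1) (ArborealSurface.star n (m - n + 1)),
        ∀ φ : ArborealSurface.rigidHomeo n m (ArborealSurface.sharp n m),
          ∃ χ : ArborealSurface.rigidHomeo n (m - n + 1) (ArborealSurface.star n (m - n + 1)),
            (χ : ArborealSurface.surface n (m - n + 1) (ArborealSurface.star n (m - n + 1)) ≃ₜ
                ArborealSurface.surface n (m - n + 1) (ArborealSurface.star n (m - n + 1))) =
              (ψ.symm.trans φ.1).trans ψ ∧
            Φ (QuotientGroup.mk φ) = QuotientGroup.mk χ := by
  obtain ⟨r, rfl⟩ := Nat.exists_eq_add_of_le hnm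
  rw [Nat.add_sub_cancel_left]
  obtain ⟨ψ, hψ, hroot, hnode⟩ := ArborealSurface.exists_homeomorph_surface n r
  have h := ArborealSurface.identifiesAfterMerging_of_image hroot hnode
  obtain ⟨K', hK'⟩ := h.matchesOff
  exact ⟨ψ, _, ArborealSurface.tree_adj_root n 0, h, ArborealSurface.exists_amod_mulEquiv hψ hK'⟩
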